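/- Let $\Lambda$ be an artin algebra and $\mathcal C=\mathrm{mod}\,\Lambda$ the category of finitely generated left $\Lambda$-modules. Let $\mathrm{mod}(\mathcal C)$ be the abelian category of finitely presented contravariant functors from $\mathcal C$ to abelian groups, and let $\mathrm{maps}(\mathcal C)$ be the category whose objects $(A_1,A_0,f)$ are the morphisms $f:A_1\to A_0$ of $\mathcal C$ and whose morphisms are commutative squares. Put $\Phi(f:A_1\to A_0)=\mathrm{Coker}\big((-,A_1)\to(-,A_0)\big)\in\mathrm{mod}(\mathcal C)$, and for a projective resolution $P_\bullet=(\cdots\to(-,A_2)\to(-,A_1)\to(-,A_0)\to 0)$ in $\mathrm{mod}(\mathcal C)$ put $\Psi(P_\bullet)=(A_1\to A_0)$. Two morphisms $(h_1,h_0),(h_1',h_0')$ from $f:A_1\to A_0$ to $g:B_1\to B_0$ are homotopic if $h_0-h_0'=gs$ for some $s:A_0\to B_1$. A sequence $0\to N\to E\to M\to 0$ in $\mathrm{maps}(\mathcal C)$ is $F$-exact if the three induced sequences of sources, of targets and of kernels of the maps are split exact. A map $P$ is $F$-projective if $\mathrm{Hom}(P,-)$ is exact on $F$-exact sequences; every object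 has an $F$-exact projective resolution (one that is spliced from $F$-exact sequences), and $\mathrm{Ext}^k_F$ and the relative projective dimension are computed by such resolutions. A longer sequence is relative exact if it is spliced from $F$-exact sequences. All subcategories are full and closed under isomorphisms, finite direct sums and direct summands. * A subcategory $\mathcal T$ of $\mathrm{mod}(\mathcal C)$ is generalized tilting if there is $n$ such that all its objects have projective dimension $\le n$, if $\mathrm{Ext}^k(T,T')=0$ for all $T,T'\in\mathcal T$ and $k\ge1$, and if for each $C\in\mathcal C$ there is an exact sequence $0\to(-,C)\to T^0\to\cdots\to T^m\to0$ with all $T^i\in\mathcal T$. * A subcategory $\mathcal T$ of $\mathrm{maps}(\mathcal C)$ is relative tilting if all its objects have finite relative projective dimension, if $\mathrm{Ext}^k_F(T,T')=0$ for all $T,T'\in\mathcal T$ and $k\ge1$, and if for each $C\in\mathcal C$ there is a relative exact sequence $0\to(0,C,0)\to T^0\to\cdots\to T^m\to0$ with all $T^i\in\mathcal T$, where $(0,C,0)$ is the map $0\to C$. For a subcategory $\mathcal T$ of $\mathrm{maps}(\mathcal C)$ consider the two properties: (i) $\mathrm{Ext}^k_F(T,T')=0$ for all $T,T'\in\mathcal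 T$ and $0<k\le2$; (ii) for each $C\in\mathcal C$ there is a relative exact sequence $0\to(0,C,0)\to T^0\to T^1\to T^2\to0$ with $T^0,T^1,T^2\in\mathcal T$. **Theorem.** (a) Sending a subcategory $\mathcal T$ of $\mathrm{mod}(\mathcal C)$ to the subcategory of all maps isomorphic to $\Psi(P_\bullet)$, for $P_\bullet$ a projective resolution of an object of $\mathcal T$, defines a bijection from the generalized tilting subcategories of $\mathrm{mod}(\mathcal C)$ onto the relative tilting subcategories of $\mathrm{maps}(\mathcal C)$ that are closed under homotopy equivalence and satisfy (i) and (ii). The inverse sends $\mathcal T$ to $\Phi(\mathcal T)$, the subcategory of all functors isomorphic to $\Phi(f)$ with $f\in\mathcal T$. (b) For every relative tilting subcategory $\mathcal T$ of $\mathrm{maps}(\mathcal C)$ with (i) and (ii), closed under homotopy equivalence or not, $\Phi(\mathcal T)$ is a generalized tilting subcategory of $\mathrm{mod}(\mathcal C)$. (c) A subcategory of $\mathrm{maps}(\mathcal C)$ is relative tilting if and only if it satisfies (i) and (ii). -/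

import Mathlib

open CategoryTheory Limits Opposite
open scoped ZeroObject

universe v u

noncomputable section

namespace MapsTilting

/-! ### Finitely presented contravariant functors -/

lemma exact_app {C : Type u} [Category.{v} C] {S : ShortComplex (Cᵒᵖ ⥤ AddCommGrpCat.{v})} (h : S.Exact) (X : Cᵒᵖ)
    (x : S.X₂.obj X) (hx : S.g.app X x = 0) : ∃ y, S.f.app X y = x :=
  (ShortComplex.ab_exact_iff _).1 (h.map ((evaluation _ _).obj X)) x hx

lemma exact_of_app {C : Type u} [Category.{v} C] {S : ShortComplex (Cᵒᵖ ⥤ AddCommGrpCat.{v})}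
    (h : ∀ (X : Cᵒᵖ) (x : S.X₂.obj X), S.g.app X x = 0 → ∃ y, S.f.app X y = x) : S.Exact := by
  rw [S.exact_iff_isZero_homology, Functor.isZero_iff]
  intro X
  have := (ShortComplex.ab_exact_iff (S.map ((evaluation _ _).obj X))).2 (h X)
  rw [ShortComplex.exact_iff_isZero_homology] at this
  exact this.of_iso (S.mapHomologyIso ((evaluation _ _).obj X)).symm

section FinitelyPresented

variable (C : Type u) [Category.{v} C] [Preadditive C]

instance preadditiveYonedaAdditive : (preadditiveYoneda (C := C)).Additive where
  map_add {X Y f g} := by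
    ext Z a
    exact Preadditive.comp_add _ _ _ _ _ _

/-- A contravariant functor `F` to abelian groups is finitely presented if there is an exact
sequence `(-, C₁) ⟶ (-, C₀) ⟶ F ⟶ 0`. -/
def FinPres : ObjectProperty (Cᵒᵖ ⥤ AddCommGrpCat.{v}) := fun F =>
  ∃ (C₁ C₀ : C) (f : C₁ ⟶ C₀) (π : preadditiveYoneda.obj C₀ ⟶ F)
    (w : preadditiveYoneda.map f ≫ π = 0),
    (ShortComplex.mk (preadditiveYoneda.map f) π w).Exact ∧ Epi π

/-- `mod(C)`: the category of finitely presented contravariant functors. -/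
abbrev FinPresFunctor := (FinPres C).FullSubcategory

variable {C}

lemma finPres_iff (F : Cᵒᵖ ⥤ AddCommGrpCat.{v}) :
    FinPres C F ↔ ∃ (C₁ C₀ : C) (f : C₁ ⟶ C₀) (π : preadditiveYoneda.obj C₀ ⟶ F),
      (∀ (X : C) (y : F.obj (op X)), ∃ a : X ⟶ C₀, π.app (op X) a = y) ∧
      (∀ (X : C) (a : X ⟶ C₀), π.app (op X) a = 0 ↔ ∃ b : X ⟶ C₁, b ≫ f = a) := by
  constructor
  · rintro ⟨C₁, C₀, f, π, w, h, he⟩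
    refine ⟨C₁, C₀, f, π, fun X y => ?_, fun X a => ⟨fun ha => exact_app h (op X) a ha, ?_⟩⟩
    · have : Epi (π.app (op X)) := inferInstance
      exact (AddCommGrpCat.epi_iff_surjective _).1 this y
    · rintro ⟨b, rfl⟩
      exact ConcreteCategory.congr_hom (congr_app w (op X)) b
  · rintro ⟨C₁, C₀, f, π, h₁, h₂⟩
    refine ⟨C₁, C₀, f, π, ?_, exact_of_app fun X a ha => (h₂ X.unop a).1 ha, ?_⟩
    · ext X a
      exact (h₂ X.unop _).2 ⟨a, rfl⟩
    · have : ∀ X, Epi (π.app X) := fun X =>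
        (AddCommGrpCat.epi_iff_surjective _).2 fun y => h₁ X.unop y
      exact NatTrans.epi_of_epi_app π

lemma yoneda_app_eq {A : C} {F : Cᵒᵖ ⥤ AddCommGrpCat.{v}} (ψ : preadditiveYoneda.obj A ⟶ F)
    {X : C} (a : X ⟶ A) : ψ.app (op X) a = F.map a.op (ψ.app (op A) (𝟙 A)) := by
  have := ConcreteCategory.congr_hom (ψ.naturality a.op) (𝟙 A)
  refine Eq.trans ?_ this
  change ψ.app (op X) a = ψ.app (op X) (a ≫ 𝟙 A)
  rw [Category.comp_id]

/-- Lifting of a map from a representable functor through an objectwise surjective map. -/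
lemma yoneda_lift {A B : C} {F : Cᵒᵖ ⥤ AddCommGrpCat.{v}} (ψ : preadditiveYoneda.obj A ⟶ F)
    (π : preadditiveYoneda.obj B ⟶ F)
    (h : ∀ (X : C) (y : F.obj (op X)), ∃ a : X ⟶ B, π.app (op X) a = y) :
    ∃ φ : A ⟶ B, ∀ (X : C) (a : X ⟶ A), ψ.app (op X) a = π.app (op X) (a ≫ φ) := by
  obtain ⟨φ, hφ⟩ := h A (ψ.app (op A) (𝟙 A))
  refine ⟨φ, fun X a => ?_⟩
  rw [yoneda_app_eq, ← hφ]
  exact (ConcreteCategory.congr_hom (π.naturality a.op) φ).symm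

lemma yoneda_app_add {A : C} {F : Cᵒᵖ ⥤ AddCommGrpCat.{v}} (ψ : preadditiveYoneda.obj A ⟶ F)
    {X : C} (a b : X ⟶ A) :
    ψ.app (op X) (a + b : X ⟶ A) = ψ.app (op X) a + ψ.app (op X) b :=
  map_add (ψ.app (op X)).hom a b

lemma yoneda_app_sub {A : C} {F : Cᵒᵖ ⥤ AddCommGrpCat.{v}} (ψ : preadditiveYoneda.obj A ⟶ F)
    {X : C} (a b : X ⟶ A) :
    ψ.app (op X) (a - b : X ⟶ A) = ψ.app (op X) a - ψ.app (op X) b :=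
  map_sub (ψ.app (op X)).hom a b

instance finPresIso : (FinPres C).IsClosedUnderIsomorphisms where
  of_iso := by
    rintro F G e ⟨C₁, C₀, f, π, w, h, he⟩
    refine ⟨C₁, C₀, f, π ≫ e.hom, by rw [← Category.assoc, w, zero_comp], ?_, epi_comp _ _⟩
    let α : ShortComplex.mk (preadditiveYoneda.map f) π w ≅
        ShortComplex.mk (preadditiveYoneda.map f) (π ≫ e.hom)
          (by rw [← Category.assoc, w, zero_comp]) :=
      ShortComplex.isoMk (Iso.refl _) (Iso.refl _) e (by simp) (by simp)
    exact (ShortComplex.exact_iff_of_iso α).1 h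

lemma finPres_cokernel_map {C₁ C₀ : C} (f : C₁ ⟶ C₀) :
    FinPres C (cokernel (preadditiveYoneda.map f)) :=
  ⟨C₁, C₀, f, cokernel.π _, cokernel.condition _, ShortComplex.exact_cokernel _, inferInstance⟩

instance finPresClosedUnderCokernels [HasBinaryBiproducts C] :
    (FinPres C).IsClosedUnderCokernels where
  cokernels_le := by
    rintro _ ⟨f, k, hk, hF, hG⟩
    rename_i F G
    obtain ⟨A₁, A₀, u, πF, hF₁, hF₂⟩ := (finPres_iff F).1 hF
    obtain ⟨B₁, B₀, g, πG, hG₁, hG₂⟩ := (finPres_iff G).1 hG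
    obtain ⟨φ, hφ⟩ := yoneda_lift (πF ≫ f) πG hG₁
    have hex : (ShortComplex.mk f k.π k.condition).Exact :=
      ShortComplex.exact_of_g_is_cokernel _
        (IsColimit.ofIsoColimit hk (Cofork.ext (Iso.refl _) (by simp)))
    have hepi : Epi k.π := epi_of_isColimit_cofork hk
    have hw : ∀ (X : C) (y : F.obj (op X)), k.π.app (op X) (f.app (op X) y) = 0 := fun X y =>
      ConcreteCategory.congr_hom (congr_app k.condition (op X)) y
    refine (finPres_iff _).2 ⟨B₁ ⊞ A₀, B₀, biprod.desc g φ, πG ≫ k.π, ?_, ?_⟩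
    · intro X y
      have : Epi (k.π.app (op X)) := inferInstance
      obtain ⟨z, rfl⟩ := (AddCommGrpCat.epi_iff_surjective _).1 this y
      obtain ⟨a, rfl⟩ := hG₁ X z
      exact ⟨a, rfl⟩
    · intro X a
      change k.π.app (op X) (πG.app (op X) a) = 0 ↔ _
      constructor
      · intro h
        obtain ⟨y, hy⟩ := exact_app hex (op X) _ h
        obtain ⟨c, rfl⟩ := hF₁ X y
        have hc : f.app (op X) (πF.app (op X) c) = πG.app (op X) (c ≫ φ) := hφ X c
        have h₀ : πG.app (op X) (a - c ≫ φ : X ⟶ B₀) = 0 := by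
          rw [yoneda_app_sub, ← hc, sub_eq_zero]
          exact hy.symm
        obtain ⟨b, hb⟩ := (hG₂ X _).1 h₀
        exact ⟨biprod.lift b c, by rw [biprod.lift_desc, hb, sub_add_cancel]⟩
      · rintro ⟨b, rfl⟩
        have : b ≫ biprod.desc g φ = (b ≫ biprod.fst) ≫ g + (b ≫ biprod.snd) ≫ φ := by
          rw [biprod.desc_eq]; simp
        rw [this, yoneda_app_add, (hG₂ X _).2 ⟨_, rfl⟩, zero_add, ← hφ X]
        exact hw X _

lemma kernel_desc_neg [HasBinaryBiproducts C] [HasKernels C] {X Y Z : C} (f : X ⟶ Z)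
    (g : Y ⟶ Z) : kernel.ι (biprod.desc f (-g)) ≫ biprod.snd ≫ g =
      kernel.ι (biprod.desc f (-g)) ≫ biprod.fst ≫ f := by
  have h := kernel.condition (biprod.desc f (-g))
  have h' : biprod.desc f (-g) = biprod.fst ≫ f - biprod.snd ≫ g := by
    ext <;> simp
  have := congrArg (fun t => kernel.ι (biprod.desc f (-g)) ≫ t) h'
  simp only [h, Preadditive.comp_sub] at this
  exact (sub_eq_zero.1 this.symm).symm

instance finPresClosedUnderKernels [HasBinaryBiproducts C] [HasKernels C] :
    (FinPres C).IsClosedUnderKernels where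
  kernels_le := by
    rintro _ ⟨f, k, hk, hF, hG⟩
    rename_i F G
    obtain ⟨A₁, A₀, u, πF, hF₁, hF₂⟩ := (finPres_iff F).1 hF
    obtain ⟨B₁, B₀, g, πG, hG₁, hG₂⟩ := (finPres_iff G).1 hG
    obtain ⟨φ, hφ⟩ := yoneda_lift (πF ≫ f) πG hG₁
    have hex : (ShortComplex.mk k.ι f k.condition).Exact :=
      ShortComplex.exact_of_f_is_kernel _
        (IsLimit.ofIsoLimit hk (Fork.ext (Iso.refl _) (by simp)))
    have hmono : Mono k.ι := mono_of_isLimit_fork hk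
    have hinj : ∀ X : C, Function.Injective (k.ι.app (op X)) := fun X =>
      (AddCommGrpCat.mono_iff_injective _).1 inferInstance
    let p : kernel (biprod.desc φ (-g)) ⟶ A₀ := kernel.ι (biprod.desc φ (-g)) ≫ biprod.fst
    have hp : ∀ (X : C) (a : X ⟶ A₀), f.app (op X) (πF.app (op X) a) = 0 ↔
        ∃ c, c ≫ p = a := by
      intro X a
      have ha : f.app (op X) (πF.app (op X) a) = πG.app (op X) (a ≫ φ) := hφ X a
      rw [ha, hG₂]
      constructor
      · rintro ⟨b, hb⟩
        exact ⟨kernel.lift _ (biprod.lift a b) (by simp [hb]), by simp [p]⟩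
      · rintro ⟨c, rfl⟩
        refine ⟨c ≫ kernel.ι _ ≫ biprod.snd, ?_⟩
        simp only [p, Category.assoc, kernel_desc_neg]
    have hpf : (preadditiveYoneda.map p ≫ πF) ≫ f = 0 := by
      ext X c
      exact (hp X.unop _).2 ⟨c, rfl⟩
    let ρ : preadditiveYoneda.obj (kernel (biprod.desc φ (-g))) ⟶ k.pt :=
      Fork.IsLimit.lift hk (preadditiveYoneda.map p ≫ πF) (by rw [hpf, comp_zero])
    have hρ : ρ ≫ k.ι = preadditiveYoneda.map p ≫ πF := Fork.IsLimit.lift_ι hk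
    have hρ' : ∀ (X : C) (c : X ⟶ kernel (biprod.desc φ (-g))),
        k.ι.app (op X) (ρ.app (op X) c) = πF.app (op X) (c ≫ p) := fun X c =>
      ConcreteCategory.congr_hom (congr_app hρ (op X)) c
    refine (finPres_iff _).2 ⟨kernel (biprod.desc p (-u)), kernel (biprod.desc φ (-g)),
      kernel.ι (biprod.desc p (-u)) ≫ biprod.fst, ρ, ?_, ?_⟩
    · intro X y
      obtain ⟨a, ha⟩ := hF₁ X (k.ι.app (op X) y)
      have h₀ : f.app (op X) (πF.app (op X) a) = 0 := by
        rw [ha]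
        exact ConcreteCategory.congr_hom (congr_app k.condition (op X)) y
      obtain ⟨c, rfl⟩ := (hp X a).1 h₀
      exact ⟨c, hinj X (by rw [hρ', ha])⟩
    · intro X c
      have : ρ.app (op X) c = 0 ↔ πF.app (op X) (c ≫ p) = 0 := by
        rw [← hρ', ← (hinj X).eq_iff, map_zero]
      rw [this, hF₂]
      constructor
      · rintro ⟨b, hb⟩
        exact ⟨kernel.lift _ (biprod.lift c b) (by simp [hb]), by simp⟩
      · rintro ⟨d, rfl⟩
        refine ⟨d ≫ kernel.ι _ ≫ biprod.snd, ?_⟩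
        simp only [Category.assoc, kernel_desc_neg]

instance finPresContainsZero [HasZeroObject C] : (FinPres C).ContainsZero where
  exists_zero := ⟨0, isZero_zero _, (finPres_iff _).2 ⟨0, 0, 0, 0, fun X y => ⟨0, by
    have : IsZero ((0 : Cᵒᵖ ⥤ AddCommGrpCat.{v}).obj (op X)) :=
      (Functor.isZero_iff _).1 (isZero_zero _) _
    exact (AddCommGrpCat.subsingleton_of_isZero this).elim _ _⟩,
    fun X a => ⟨fun _ => ⟨0, (isZero_zero C).eq_of_tgt _ _⟩, fun _ => rfl⟩⟩⟩

instance finPresClosedUnderBinaryProducts [HasBinaryBiproducts C] :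
    (FinPres C).IsClosedUnderBinaryProducts where
  limitsOfShape_le := by
    rintro P ⟨p⟩
    have hF := p.prop_diag_obj ⟨WalkingPair.left⟩
    have hG := p.prop_diag_obj ⟨WalkingPair.right⟩
    set F := p.diag.obj ⟨WalkingPair.left⟩
    set G := p.diag.obj ⟨WalkingPair.right⟩
    have e : F ⊞ G ≅ P := (biprod.isoProd F G) ≪≫
      IsLimit.conePointsIsoOfNatIso (limit.isLimit (pair F G)) p.isLimit
        (Discrete.natIso (by rintro ⟨_ | _⟩ <;> exact Iso.refl _))
    refine (FinPres C).prop_of_iso e ?_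
    obtain ⟨A₁, A₀, u, πF, hF₁, hF₂⟩ := (finPres_iff F).1 hF
    obtain ⟨B₁, B₀, g, πG, hG₁, hG₂⟩ := (finPres_iff G).1 hG
    have hfst : ∀ (X : C) (y : F.obj (op X)) (z : G.obj (op X)),
        (biprod.fst : F ⊞ G ⟶ F).app (op X) ((biprod.inl : F ⟶ F ⊞ G).app (op X) y +
          (biprod.inr : G ⟶ F ⊞ G).app (op X) z) = y := by
      intro X y z
      have h₁ := ConcreteCategory.congr_hom
        (congr_app (biprod.inl_fst : (biprod.inl : F ⟶ F ⊞ G) ≫ biprod.fst = _) (op X)) y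
      have h₂ := ConcreteCategory.congr_hom
        (congr_app (biprod.inr_fst : (biprod.inr : G ⟶ F ⊞ G) ≫ biprod.fst = _) (op X)) z
      rw [map_add]
      exact (congrArg₂ (· + ·) h₁ h₂).trans (add_zero y)
    have hsnd : ∀ (X : C) (y : F.obj (op X)) (z : G.obj (op X)),
        (biprod.snd : F ⊞ G ⟶ G).app (op X) ((biprod.inl : F ⟶ F ⊞ G).app (op X) y +
          (biprod.inr : G ⟶ F ⊞ G).app (op X) z) = z := by
      intro X y z
      have h₁ := ConcreteCategory.congr_hom
        (congr_app (biprod.inl_snd : (biprod.inl : F ⟶ F ⊞ G) ≫ biprod.snd = _) (op X)) y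
      have h₂ := ConcreteCategory.congr_hom
        (congr_app (biprod.inr_snd : (biprod.inr : G ⟶ F ⊞ G) ≫ biprod.snd = _) (op X)) z
      rw [map_add]
      exact (congrArg₂ (· + ·) h₁ h₂).trans (zero_add z)
    have htot : ∀ (X : C) (x : (F ⊞ G).obj (op X)),
        (biprod.inl : F ⟶ F ⊞ G).app (op X) ((biprod.fst : F ⊞ G ⟶ F).app (op X) x) +
          (biprod.inr : G ⟶ F ⊞ G).app (op X) ((biprod.snd : F ⊞ G ⟶ G).app (op X) x) = x :=
      fun X x => ConcreteCategory.congr_hom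
        (congr_app (biprod.total : _ = 𝟙 (F ⊞ G)) (op X)) x
    let π : preadditiveYoneda.obj (A₀ ⊞ B₀) ⟶ F ⊞ G :=
      (preadditiveYoneda.map biprod.fst ≫ πF) ≫ biprod.inl +
        (preadditiveYoneda.map biprod.snd ≫ πG) ≫ biprod.inr
    have hπ : ∀ (X : C) (a : X ⟶ A₀ ⊞ B₀), π.app (op X) a =
        (biprod.inl : F ⟶ F ⊞ G).app (op X) (πF.app (op X) (a ≫ biprod.fst)) +
          (biprod.inr : G ⟶ F ⊞ G).app (op X) (πG.app (op X) (a ≫ biprod.snd)) :=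
      fun X a => rfl
    refine (finPres_iff _).2 ⟨A₁ ⊞ B₁, A₀ ⊞ B₀, biprod.map u g, π, ?_, ?_⟩
    · intro X x
      obtain ⟨a, ha⟩ := hF₁ X ((biprod.fst : F ⊞ G ⟶ F).app (op X) x)
      obtain ⟨b, hb⟩ := hG₁ X ((biprod.snd : F ⊞ G ⟶ G).app (op X) x)
      refine ⟨biprod.lift a b, ?_⟩
      rw [hπ, biprod.lift_fst, biprod.lift_snd, ha, hb, htot]
    · intro X a
      rw [hπ]
      constructor
      · intro h
        have h₁ := hfst X (πF.app (op X) (a ≫ biprod.fst)) (πG.app (op X) (a ≫ biprod.snd))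
        have h₂ := hsnd X (πF.app (op X) (a ≫ biprod.fst)) (πG.app (op X) (a ≫ biprod.snd))
        rw [h, map_zero] at h₁ h₂
        obtain ⟨b, hb⟩ := (hF₂ X _).1 h₁.symm
        obtain ⟨c, hc⟩ := (hG₂ X _).1 h₂.symm
        refine ⟨biprod.lift b c, ?_⟩
        ext <;> simp [hb, hc]
      · rintro ⟨b, rfl⟩
        rw [(hF₂ X _).2 ⟨b ≫ biprod.fst, by simp⟩, (hG₂ X _).2 ⟨b ≫ biprod.snd, by simp⟩,
          map_zero, map_zero, add_zero]

instance finPresClosedUnderFiniteProducts [HasBinaryBiproducts C] [HasZeroObject C] :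
    (FinPres C).IsClosedUnderFiniteProducts :=
  ObjectProperty.IsClosedUnderFiniteProducts.mk'

/-- Since `C` has kernels, `mod(C)` is an abelian category. -/
instance finPresAbelian (C : Type u) [Category.{v} C] [Abelian C] :
    Abelian (FinPresFunctor C) :=
  inferInstanceAs (Abelian (FinPres C).FullSubcategory)

end FinitelyPresented

variable (C : Type u) [Category.{v} C] [Abelian C]

/-! ### Subcategories -/

/-- Full subcategories that are closed under isomorphisms, finite direct sums and direct summands.
(In the categories below idempotents split, so that direct summands are the same as retracts.) -/
structure IsAdditiveSubcategory {D : Type*} [Category* D] (P : ObjectProperty D) : Prop where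
  closedUnderSums : P.IsClosedUnderFiniteProducts
  closedUnderSummands : P.IsStableUnderRetracts

/-! ### Generalized tilting subcategories of `mod(C)` -/

instance hasExtFinPres : HasExt.{max u (v + 1)} (FinPresFunctor C) := HasExt.standard _

variable {C}

/-- The representable functor `(-, X)` as an object of `mod(C)`. -/
def representable (X : C) : FinPresFunctor C :=
  ⟨preadditiveYoneda.obj X, (finPres_iff _).2 ⟨0, X, 0, 𝟙 _, fun _ y => ⟨y, rfl⟩, fun Y a =>
    ⟨fun ha => ⟨0, by rw [zero_comp]; exact ha.symm⟩, by
      rintro ⟨b, rfl⟩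
      rw [comp_zero]
      rfl⟩⟩⟩

/-- `HasCoresolution T n M`: there is an exact sequence
`0 ⟶ M ⟶ T⁰ ⟶ T¹ ⟶ ⋯ ⟶ Tⁿ ⟶ 0` with all `Tⁱ` in `T`, cut into short exact sequences. -/
def HasCoresolution {A : Type*} [Category* A] [Abelian A] (T : ObjectProperty A) : ℕ → A → Prop
  | 0, M => T M
  | n + 1, M => ∃ (T₀ K : A) (i : M ⟶ T₀) (p : T₀ ⟶ K) (w : i ≫ p = 0),
      T T₀ ∧ (ShortComplex.mk i p w).ShortExact ∧ HasCoresolution T n K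

/-- Generalized tilting subcategories of `mod(C)`. -/
structure IsGeneralizedTilting (T : ObjectProperty (FinPresFunctor C)) : Prop where
  additive : IsAdditiveSubcategory T
  projDim : ∃ n : ℕ, ∀ M, T M → HasProjectiveDimensionLE M n
  ext_vanishing : ∀ M N, T M → T N → ∀ k : ℕ, 1 ≤ k → Subsingleton (Abelian.Ext M N k)
  coresolution : ∀ X : C, ∃ n : ℕ, HasCoresolution T n (representable X)

/-! ### The category of maps -/

/-- The functor `Φ : maps(C) ⥤ mod(C)`, `(f : A₁ ⟶ A₀) ↦ Coker ((-, A₁) ⟶ (-, A₀))`. -/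
def Phi (C : Type u) [Category.{v} C] [Abelian C] : Arrow C ⥤ FinPresFunctor C :=
  (FinPres C).lift (preadditiveYoneda.mapArrow ⋙ coker _) fun f => finPres_cokernel_map f.hom

/-- Complexes `⋯ ⟶ A₂ ⟶ A₁ ⟶ A₀ ⟶ 0` in `C` such that `⋯ ⟶ (-, A₂) ⟶ (-, A₁) ⟶ (-, A₀) ⟶ 0` is
exact outside degree `0`, that is, a projective resolution in `mod(C)`. -/
def IsProjRes (C : Type u) [Category.{v} C] [Abelian C] : ObjectProperty (ChainComplex C ℕ) :=
  fun A => ∀ n : ℕ, 1 ≤ n →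
    ((preadditiveYoneda.mapHomologicalComplex (ComplexShape.down ℕ)).obj A).ExactAt n

/-- The functor `Ψ` from projective resolutions to maps,
`(⋯ ⟶ (-, A₂) ⟶ (-, A₁) ⟶ (-, A₀) ⟶ 0) ↦ (A₁ ⟶ A₀)`. -/
def Psi (C : Type u) [Category.{v} C] [Abelian C] : (IsProjRes C).FullSubcategory ⥤ Arrow C where
  obj P := Arrow.mk (P.obj.d 1 0)
  map φ := Arrow.homMk (φ.hom.f 1) (φ.hom.f 0) (φ.hom.comm 1 0)

/-- `Θ = Φ Ψ`, which sends a projective resolution to the functor that it resolves. -/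
abbrev Theta (C : Type u) [Category.{v} C] [Abelian C] :
    (IsProjRes C).FullSubcategory ⥤ FinPresFunctor C := Psi C ⋙ Phi C

/-- The subcategory of `maps(C)` that corresponds under `Ψ` to the subcategory `T` of `mod(C)`:
the maps isomorphic to `Ψ P`, for `P` a projective resolution of an object of `T`. -/
def underPsi (T : ObjectProperty (FinPresFunctor C)) : ObjectProperty (Arrow C) :=
  (T.inverseImage (Theta C)).map (Psi C)

/-- Closure under homotopy equivalence of maps. Two morphisms `h, h'` from `f : A₁ ⟶ A₀` to
`g : B₁ ⟶ B₀` are homotopic if `h₀ - h₀'` factors through `g`; the quotient category is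
`Preadditive.RightFreyd C`. -/
def IsHomotopyClosed (T : ObjectProperty (Arrow C)) : Prop :=
  ∀ f g : Arrow C, Nonempty ((Preadditive.RightFreyd.quotient C).obj f ≅
    (Preadditive.RightFreyd.quotient C).obj g) → T f → T g

/-! ### The exact structure on the category of maps -/

instance leftFuncPreservesZero : (Arrow.leftFunc (C := C)).PreservesZeroMorphisms where

instance rightFuncPreservesZero : (Arrow.rightFunc (C := C)).PreservesZeroMorphisms where

instance kerPreservesZero : (ker C).PreservesZeroMorphisms where
  map_zero X Y := by
    apply (cancel_mono (kernel.ι Y.hom)).1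
    exact (kernel.lift_ι _ _ _).trans (comp_zero.trans zero_comp.symm)

/-- A sequence `0 ⟶ N ⟶ E ⟶ M ⟶ 0` of maps is `F`-exact if the three columns that it induces
on sources, on targets and on kernels are split exact. -/
structure IsFExact (S : ShortComplex (Arrow C)) : Prop where
  left : Nonempty (S.map Arrow.leftFunc).Splitting
  right : Nonempty (S.map Arrow.rightFunc).Splitting
  ker : Nonempty (S.map (Limits.ker C)).Splitting

/-- `P` is `F`-projective if `Hom(P, -)` is exact on `F`-exact sequences. -/
def IsFProjective (P : Arrow C) : Prop :=
  ∀ S : ShortComplex (Arrow C), IsFExact S → ∀ f : P ⟶ S.X₃, ∃ g : P ⟶ S.X₂, g ≫ S.g = f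

/-- An `F`-exact projective resolution `⋯ ⟶ P₁ ⟶ P₀ ⟶ X ⟶ 0`, cut into the `F`-exact sequences
`0 ⟶ Kₙ₊₁ ⟶ Pₙ ⟶ Kₙ ⟶ 0`, with `K₀ ≅ X`. -/
structure FProjectiveResolution (X : Arrow C) where
  /-- the terms `Pₙ` -/
  obj : ℕ → Arrow C
  /-- the images `Kₙ` of the differentials -/
  syz : ℕ → Arrow C
  ι : ∀ n, syz (n + 1) ⟶ obj n
  π : ∀ n, obj n ⟶ syz n
  w : ∀ n, ι n ≫ π n = 0
  fexact : ∀ n, IsFExact (ShortComplex.mk (ι n) (π n) (w n))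
  fproj : ∀ n, IsFProjective (obj n)
  iso : syz 0 ≅ X

namespace FProjectiveResolution

variable {X : Arrow C} (P : FProjectiveResolution X)

/-- The differential `Pₙ₊₁ ⟶ Pₙ`. -/
def d (n : ℕ) : P.obj (n + 1) ⟶ P.obj n := P.π (n + 1) ≫ P.ι n

lemma d_comp_d (n : ℕ) : P.d (n + 1) ≫ P.d n = 0 := by
  simp only [d, Category.assoc]
  rw [← Category.assoc (P.ι (n + 1)), P.w (n + 1), zero_comp, comp_zero]

/-- The `k`-cocycles of the complex `Hom(P, Y)`. -/
def cocycles (Y : Arrow C) (k : ℕ) : AddSubgroup (P.obj k ⟶ Y) :=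
  (Preadditive.leftComp Y (P.d k)).ker

/-- The `k`-coboundaries of the complex `Hom(P, Y)`. -/
def coboundaries (Y : Arrow C) : ∀ k : ℕ, AddSubgroup (P.obj k ⟶ Y)
  | 0 => ⊥
  | k + 1 => (Preadditive.leftComp Y (P.d k)).range

/-- The `k`-th cohomology group of the complex `Hom(P, Y)`. -/
abbrev cohomology (Y : Arrow C) (k : ℕ) : Type v :=
  P.cocycles Y k ⧸ (P.coboundaries Y k).addSubgroupOf (P.cocycles Y k)

end FProjectiveResolution

/-! #### Existence of relative projective resolutions

For `X : X₁ ⟶ X₂` with kernel `X₀` there is an `F`-exact sequence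
`0 ⟶ (X₀ ⟶ X₁) ⟶ (X₀ ⟶ 0) ⊕ (X₁ = X₁) ⊕ (0 ⟶ X₂) ⟶ X ⟶ 0` with `F`-projective middle term. -/

/-- The map `X₀ ⊕ X₁ ⟶ X₁ ⊕ X₂` given by the identity of `X₁`. -/
def coverHom (X : Arrow C) : kernel X.hom ⊞ X.left ⟶ X.left ⊞ X.right := biprod.snd ≫ biprod.inl

/-- `(X₀ ⟶ 0) ⊕ (X₁ = X₁) ⊕ (0 ⟶ X₂)`. -/
abbrev cover (X : Arrow C) : Arrow C := Arrow.mk (coverHom X)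

/-- `X₀ ⟶ X₁`. -/
abbrev syzygy (X : Arrow C) : Arrow C := Arrow.mk (kernel.ι X.hom)

/-- The epimorphism from the cover. -/
def coverπ (X : Arrow C) : cover X ⟶ X :=
  Arrow.homMk (biprod.desc (kernel.ι X.hom) (𝟙 X.left) : kernel X.hom ⊞ X.left ⟶ X.left)
    (biprod.desc X.hom (𝟙 X.right) : X.left ⊞ X.right ⟶ X.right) (by
    dsimp [coverHom]
    ext <;> simp)

/-- The inclusion of the syzygy. -/
def syzygyι (X : Arrow C) : syzygy X ⟶ cover X :=
  Arrow.homMk (biprod.lift (-(𝟙 (kernel X.hom))) (kernel.ι X.hom) :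
      kernel X.hom ⟶ kernel X.hom ⊞ X.left)
    (biprod.lift (𝟙 X.left) (-X.hom) : X.left ⟶ X.left ⊞ X.right) (by
    dsimp [coverHom]
    ext <;> simp)

lemma left_zero (X : Arrow C) : (biprod.lift (-(𝟙 (kernel X.hom))) (kernel.ι X.hom) :
    kernel X.hom ⟶ kernel X.hom ⊞ X.left) ≫ biprod.desc (kernel.ι X.hom) (𝟙 X.left) = 0 := by
  simp

lemma right_zero (X : Arrow C) : (biprod.lift (𝟙 X.left) (-X.hom) :
    X.left ⟶ X.left ⊞ X.right) ≫ biprod.desc X.hom (𝟙 X.right) = 0 := by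
  simp

lemma syzygyι_coverπ (X : Arrow C) : syzygyι X ≫ coverπ X = 0 :=
  Arrow.hom_ext _ _ (left_zero X) (right_zero X)

lemma left_id (X : Arrow C) : (-biprod.fst : kernel X.hom ⊞ X.left ⟶ kernel X.hom) ≫
    biprod.lift (-(𝟙 (kernel X.hom))) (kernel.ι X.hom) +
      biprod.desc (kernel.ι X.hom) (𝟙 X.left) ≫ biprod.inr = 𝟙 (kernel X.hom ⊞ X.left) := by
  ext <;> simp

lemma right_id (X : Arrow C) : (biprod.fst : X.left ⊞ X.right ⟶ X.left) ≫
    biprod.lift (𝟙 X.left) (-X.hom) + biprod.desc X.hom (𝟙 X.right) ≫ biprod.inr =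
      𝟙 (X.left ⊞ X.right) := by
  ext <;> simp

lemma kernel_coverHom_snd (X : Arrow C) : kernel.ι (coverHom X) ≫ biprod.snd = 0 := by
  apply (cancel_mono (biprod.inl : X.left ⟶ X.left ⊞ X.right)).1
  rw [Category.assoc, zero_comp]
  exact kernel.condition (coverHom X)

lemma inl_coverHom (X : Arrow C) : biprod.inl ≫ coverHom X = 0 := by
  simp [coverHom]

lemma ker_id (X : Arrow C)
    (h : (kernel.ι (coverHom X) ≫ biprod.desc (kernel.ι X.hom) (𝟙 X.left)) ≫ X.hom = 0) :
    kernel.lift X.hom (kernel.ι (coverHom X) ≫ biprod.desc (kernel.ι X.hom) (𝟙 X.left)) h ≫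
      kernel.lift (coverHom X) biprod.inl (inl_coverHom X) = 𝟙 (kernel (coverHom X)) := by
  have h₁ : kernel.lift X.hom (kernel.ι (coverHom X) ≫ biprod.desc (kernel.ι X.hom) (𝟙 X.left)) h =
      kernel.ι (coverHom X) ≫ biprod.fst := by
    apply (cancel_mono (kernel.ι X.hom)).1
    rw [kernel.lift_ι, biprod.desc_eq, Preadditive.comp_add, Category.comp_id,
      kernel_coverHom_snd, add_zero, Category.assoc]
  apply (cancel_mono (kernel.ι (coverHom X))).1
  rw [h₁, Category.assoc, kernel.lift_ι, Category.id_comp]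
  ext
  · simp
  · simp [kernel_coverHom_snd]

lemma cover_fexact (X : Arrow C) :
    IsFExact (ShortComplex.mk (syzygyι X) (coverπ X) (syzygyι_coverπ X)) where
  left := ⟨{ r := (-biprod.fst : kernel X.hom ⊞ X.left ⟶ kernel X.hom)
             s := (biprod.inr : X.left ⟶ kernel X.hom ⊞ X.left)
             f_r := by
              change (biprod.lift (-(𝟙 (kernel X.hom))) (kernel.ι X.hom) :
                kernel X.hom ⟶ kernel X.hom ⊞ X.left) ≫ (-biprod.fst) = 𝟙 (kernel X.hom)
              simp
             s_g := (biprod.inr_desc _ _ : (biprod.inr : X.left ⟶ kernel X.hom ⊞ X.left) ≫ _ = _)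
             id := left_id X }⟩
  right := ⟨{ r := (biprod.fst : X.left ⊞ X.right ⟶ X.left)
              s := (biprod.inr : X.right ⟶ X.left ⊞ X.right)
              f_r := (biprod.lift_fst _ _ : _ ≫ (biprod.fst : X.left ⊞ X.right ⟶ X.left) = _)
              s_g := (biprod.inr_desc _ _ : (biprod.inr : X.right ⟶ X.left ⊞ X.right) ≫ _ = _)
              id := right_id X }⟩
  ker := by
    have h0 : (0 : kernel (kernel.ι X.hom) ⟶ kernel (kernel.ι X.hom)) = 𝟙 _ := by
      apply (cancel_mono (kernel.ι (kernel.ι X.hom))).1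
      apply (cancel_mono (kernel.ι X.hom)).1
      simp
    refine ⟨{ r := 0
              s := kernel.lift (coverHom X) biprod.inl (inl_coverHom X)
              f_r := comp_zero.trans h0
              s_g := ?_
              id := ?_ }⟩
    · apply (cancel_mono (kernel.ι X.hom)).1
      refine (Category.assoc _ _ _).trans ((congrArg _ (kernel.lift_ι _ _ _)).trans ?_)
      refine (Category.assoc _ _ _).symm.trans ((congrArg (· ≫ _) (kernel.lift_ι _ _ _)).trans ?_)
      exact (biprod.inl_desc _ _).trans (Category.id_comp _).symm
    · have hw : (kernel.ι (coverHom X) ≫ biprod.desc (kernel.ι X.hom) (𝟙 X.left)) ≫ X.hom = 0 := by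
        rw [Category.assoc, show biprod.desc (kernel.ι X.hom) (𝟙 X.left) ≫ X.hom =
          coverHom X ≫ biprod.desc X.hom (𝟙 X.right) from Arrow.w (coverπ X),
          kernel.condition_assoc, zero_comp]
      let m : kernel (kernel.ι X.hom) ⟶ kernel (coverHom X) := (ker C).map (syzygyι X)
      have hz : (0 : kernel (coverHom X) ⟶ kernel (kernel.ι X.hom)) ≫ m +
          kernel.lift X.hom (kernel.ι (coverHom X) ≫ biprod.desc (kernel.ι X.hom) (𝟙 X.left)) hw ≫
            kernel.lift (coverHom X) biprod.inl (inl_coverHom X) = 𝟙 (kernel (coverHom X)) := by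
        rw [ker_id, zero_comp, zero_add]
      exact hz

lemma cover_fproj (X : Arrow C) : IsFProjective (cover X) := by
  rintro S ⟨⟨σ₁⟩, ⟨σ₂⟩, ⟨σ₀⟩⟩ u
  let ul : kernel X.hom ⊞ X.left ⟶ S.X₃.left := u.left
  let ur : X.left ⊞ X.right ⟶ S.X₃.right := u.right
  have hu : ul ≫ S.X₃.hom = coverHom X ≫ ur := Arrow.w u
  let s₁ : S.X₃.left ⟶ S.X₂.left := σ₁.s
  let s₂ : S.X₃.right ⟶ S.X₂.right := σ₂.s
  let s₀ : kernel S.X₃.hom ⟶ kernel S.X₂.hom := σ₀.s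
  have hs₁ : s₁ ≫ S.g.left = 𝟙 _ := σ₁.s_g
  have hs₂ : s₂ ≫ S.g.right = 𝟙 _ := σ₂.s_g
  have hs₀ : s₀ ≫ kernel.ι S.X₂.hom ≫ S.g.left = kernel.ι S.X₃.hom := by
    have h : s₀ ≫ (ker C).map S.g = 𝟙 (kernel S.X₃.hom) := σ₀.s_g
    have h' : (ker C).map S.g ≫ kernel.ι S.X₃.hom = kernel.ι S.X₂.hom ≫ S.g.left :=
      kernel.lift_ι _ _ _
    rw [← h']
    refine (Category.assoc _ _ _).symm.trans ?_
    exact (congrArg (· ≫ kernel.ι S.X₃.hom) h).trans (Category.id_comp _)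
  have ha : (biprod.inl ≫ ul) ≫ S.X₃.hom = 0 := by
    rw [Category.assoc, hu, ← Category.assoc, inl_coverHom, zero_comp]
  have hb : (biprod.inr ≫ ul) ≫ S.X₃.hom = biprod.inl ≫ ur := by
    rw [Category.assoc, hu]
    simp [coverHom]
  have hg : S.X₂.hom ≫ S.g.right = S.g.left ≫ S.X₃.hom := (Arrow.w S.g).symm
  let vl : kernel X.hom ⊞ X.left ⟶ S.X₂.left :=
    biprod.desc (kernel.lift S.X₃.hom (biprod.inl ≫ ul) ha ≫ s₀ ≫ kernel.ι S.X₂.hom)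
      ((biprod.inr ≫ ul) ≫ s₁)
  let vr : X.left ⊞ X.right ⟶ S.X₂.right :=
    biprod.desc (((biprod.inr ≫ ul) ≫ s₁) ≫ S.X₂.hom) ((biprod.inr ≫ ur) ≫ s₂)
  have hv : vl ≫ S.X₂.hom = coverHom X ≫ vr := by
    ext
    · simp [vl, vr, coverHom]
    · simp [vl, vr, coverHom]
  have hl : vl ≫ S.g.left = ul := by
    ext
    · simp only [vl, biprod.inl_desc_assoc, Category.assoc, hs₀, kernel.lift_ι]
    · simp only [vl, biprod.inr_desc_assoc, Category.assoc, hs₁, Category.comp_id]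
  have hr : vr ≫ S.g.right = ur := by
    ext
    · rw [← hb]
      simp only [vr, biprod.inl_desc_assoc, Category.assoc, hg]
      rw [← Category.assoc s₁, hs₁, Category.id_comp]
    · simp only [vr, biprod.inr_desc_assoc, Category.assoc, hs₂, Category.comp_id]
  exact ⟨Arrow.homMk vl vr hv, Arrow.hom_ext _ _ hl hr⟩

/-- Every object has an `F`-exact projective resolution. -/
instance nonemptyFProjectiveResolution (X : Arrow C) : Nonempty (FProjectiveResolution X) := by
  let K : ℕ → Arrow C := fun n => Nat.rec X (fun _ Y => syzygy Y) n
  exact ⟨{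
    obj := fun n => cover (K n)
    syz := K
    ι := fun n => syzygyι (K n)
    π := fun n => coverπ (K n)
    w := fun n => syzygyι_coverπ (K n)
    fexact := fun n => cover_fexact (K n)
    fproj := fun n => cover_fproj (K n)
    iso := Iso.refl _ }⟩

/-- `Ext_F^k(X, Y)`: the value at `X` of the `k`-th right derived functor of `Hom(-, Y)` with
respect to `F`-exact projective resolutions. -/
def ExtF (X Y : Arrow C) (k : ℕ) : Type v :=
  (Classical.arbitrary (FProjectiveResolution X)).cohomology Y k

instance addCommGroupExtF (X Y : Arrow C) (k : ℕ) : AddCommGroup (ExtF X Y k) :=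
  inferInstanceAs (AddCommGroup ((Classical.arbitrary (FProjectiveResolution X)).cohomology Y k))

/-! ### Relative tilting subcategories of the category of maps -/

/-- The relative projective dimension of `X` is at most `n`: there is an `F`-exact projective
resolution `0 ⟶ Pₙ ⟶ ⋯ ⟶ P₀ ⟶ X ⟶ 0`, cut into `F`-exact sequences. -/
def RelProjDimLE : ℕ → Arrow C → Prop
  | 0, X => IsFProjective X
  | n + 1, X => ∃ (P K : Arrow C) (i : K ⟶ P) (p : P ⟶ X) (w : i ≫ p = 0),
      IsFProjective P ∧ IsFExact (ShortComplex.mk i p w) ∧ RelProjDimLE n K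

/-- `HasRelCoresolution T n X`: there is a relative exact sequence
`0 ⟶ X ⟶ T⁰ ⟶ T¹ ⟶ ⋯ ⟶ Tⁿ ⟶ 0` with all `Tⁱ` in `T`, cut into `F`-exact sequences. -/
def HasRelCoresolution (T : ObjectProperty (Arrow C)) : ℕ → Arrow C → Prop
  | 0, X => T X
  | n + 1, X => ∃ (T₀ K : Arrow C) (i : X ⟶ T₀) (p : T₀ ⟶ K) (w : i ≫ p = 0),
      T T₀ ∧ IsFExact (ShortComplex.mk i p w) ∧ HasRelCoresolution T n K

/-- The object `(0, X, 0)` of `maps(C)`, that is, `0 ⟶ X`. -/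
def zeroTo (X : C) : Arrow C := Arrow.mk (0 : (0 : C) ⟶ X)

/-- Relative tilting subcategories of `maps(C)`. -/
structure IsRelativeTilting (T : ObjectProperty (Arrow C)) : Prop where
  additive : IsAdditiveSubcategory T
  projDim : ∀ X, T X → ∃ n : ℕ, RelProjDimLE n X
  ext_vanishing : ∀ X Y, T X → T Y → ∀ k : ℕ, 1 ≤ k → Subsingleton (ExtF X Y k)
  coresolution : ∀ A : C, ∃ n : ℕ, HasRelCoresolution T n (zeroTo A)

/-- `Ext_F^k(X, Y) = 0` for all `X`, `Y` in `T` and `0 < k ≤ 2`. -/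
def RelExtVanishing (T : ObjectProperty (Arrow C)) : Prop :=
  ∀ X Y, T X → T Y → ∀ k : ℕ, 0 < k → k ≤ 2 → Subsingleton (ExtF X Y k)

/-- For each `A` in `C` there is a relative exact sequence
`0 ⟶ (0, A, 0) ⟶ T⁰ ⟶ T¹ ⟶ T² ⟶ 0` with `Tⁱ` in `T`. -/
def RelCoresolutions (T : ObjectProperty (Arrow C)) : Prop :=
  ∀ A : C, HasRelCoresolution T 2 (zeroTo A)

end MapsTilting

/-! ### Artin algebras -/

/-- `Λ` is an artin algebra: it is a finitely generated module over a commutative artinian ring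
`R` that acts centrally. -/
class IsArtinAlgebra (Λ : Type u) [Ring Λ] : Prop where
  exists_finite : ∃ (R : Type u) (_ : CommRing R) (_ : Algebra R Λ),
    IsArtinianRing R ∧ Module.Finite R Λ

instance isNoetherianRing_of_isArtinAlgebra (Λ : Type u) [Ring Λ] [h : IsArtinAlgebra Λ] :
    IsNoetherianRing Λ := by
  obtain ⟨R, _, _, _, _⟩ := h.exists_finite
  exact isNoetherian_of_tower R inferInstance

end

noncomputable section

namespace MapsTilting

section

variable {C : Type u} [Category.{v} C] [Abelian C]

/-! ### Representable functors and presentations in `mod(C)` -/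

/-! The functor `Phi` is full, reaches every object of `mod(C)` up to isomorphism, and kills a
morphism exactly when its target component factors through the map it lands in
(`Phi_map_eq_zero_iff`). So `mod(C)` is the category of maps modulo homotopy, and image and preimage
under `Phi` match homotopy closed subcategories of maps with isomorphism closed subcategories of
functors. Iterated kernels extend every map to a projective resolution, so the correspondence
through `Psi` is just the preimage (`underPsi_eq_inverseImage`).

The tilting conditions agree on both sides because `Phi` respects the exact structures. It sends
`F`-exact sequences to short exact ones (`IsFExact.shortExact_Phi`, a snake argument). Conversely, a
short exact sequence lifts to an `F`-exact one with prescribed presentations of its outer terms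
(`exists_fexact_lift`, a horseshoe argument), so coresolutions travel both ways. It sends the
standard covers to projectives, and null-homotopic maps out of a syzygy extend over the cover, so
`Ext_F^k` and `Ext^k` vanish together for `k ≥ 1` (`subsingleton_extF_iff`).

Since `C` has kernels, a second syzygy is a map with zero source and hence projective: all
dimensions are at most two. Bounds on projective dimension are therefore automatic, extensions
matter in degrees one and two only, and a long coresolution splits at its end until three terms
remain (`hasRelCoresolution_two_of_three`). This gives the characterization by the two properties.

Direct summands of objects of `Φ(T)` must again lie in `Φ(T)`, even if `T` is not homotopy closed.
Here, beyond making `C` abelian, the artin algebra enters: idempotents lift along `Phi`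
(`exists_idempotent_lift`), because endomorphisms satisfy monic polynomials over an artinian ring.
-/

/-- The Yoneda embedding of `C` into `mod(C)`. -/
def rep : C ⥤ FinPresFunctor C where
  obj := representable
  map f := ObjectProperty.homMk (preadditiveYoneda.map f)
  map_id X := ObjectProperty.hom_ext _ (preadditiveYoneda.map_id X)
  map_comp f g := ObjectProperty.hom_ext _ (preadditiveYoneda.map_comp f g)

instance : (rep (C := C)).Full where
  map_surjective {X Y} f := by
    obtain ⟨g, hg⟩ := (preadditiveYoneda (C := C)).map_surjective (X := X) (Y := Y) f.hom
    exact ⟨g, ObjectProperty.hom_ext _ hg⟩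

instance : (rep (C := C)).Faithful where
  map_injective {X Y f g} h := by
    have h' : (rep.map f).hom = (rep.map g).hom := by rw [h]
    exact preadditiveYoneda.map_injective h'

instance : (rep (C := C)).Additive where
  map_add := ObjectProperty.hom_ext _ (preadditiveYoneda.map_add)

/-- The cokernel taken among all functors is again finitely presented, so an epimorphism of `mod(C)`
sees it and forces it to vanish. -/
lemma epi_hom {F G : FinPresFunctor C} (f : F ⟶ G) [Epi f] : Epi f.hom := by
  have hG : FinPres C (cokernel f.hom) := (FinPres C).prop_cokernel f.hom F.property G.property
  let q : G ⟶ ⟨cokernel f.hom, hG⟩ := ObjectProperty.homMk (cokernel.π f.hom)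
  have hq : f ≫ q = f ≫ 0 := by
    rw [comp_zero]
    exact ObjectProperty.hom_ext _ (cokernel.condition f.hom)
  have hq' : q.hom = (0 : G ⟶ ⟨cokernel f.hom, hG⟩).hom := by rw [(cancel_epi f).1 hq]
  exact Preadditive.epi_of_cokernel_zero hq'

lemma epi_of_epi_hom {F G : FinPresFunctor C} (f : F ⟶ G) (h : Epi f.hom) : Epi f :=
  (FinPres C).ι.epi_of_epi_map h

instance (W : C) : Projective (rep.obj W) where
  factors {E X} f e he := by
    obtain ⟨B, B₀, -, π, h, -⟩ := (finPres_iff E.obj).1 E.property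
    have := epi_hom e
    obtain ⟨φ, hφ⟩ := yoneda_lift (A := W) f.hom (π ≫ e.hom) fun Y y => by
      obtain ⟨z, rfl⟩ := (AddCommGrpCat.epi_iff_surjective (e.hom.app (op Y))).1 inferInstance y
      obtain ⟨a, rfl⟩ := h Y z
      exact ⟨a, rfl⟩
    refine ⟨ObjectProperty.homMk (preadditiveYoneda.map φ ≫ π), ObjectProperty.hom_ext _ ?_⟩
    ext Y a
    exact (hφ Y.unop a).symm

/-- The projection from the functor represented by the target of a map. -/
def toPhi (X : Arrow C) : rep.obj X.right ⟶ (Phi C).obj X :=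
  ObjectProperty.homMk (cokernel.π (preadditiveYoneda.map X.hom))

instance (X : Arrow C) : Epi (toPhi X) :=
  epi_of_epi_hom _ (inferInstanceAs (Epi (cokernel.π (preadditiveYoneda.map X.hom))))

lemma toPhi_naturality {X Y : Arrow C} (φ : X ⟶ Y) :
    toPhi X ≫ (Phi C).map φ = rep.map φ.right ≫ toPhi Y :=
  ObjectProperty.hom_ext _ (cokernel.π_desc _ _ _)

lemma toPhi_naturality_assoc {X Y : Arrow C} (φ : X ⟶ Y) {M : FinPresFunctor C}
    (g : (Phi C).obj Y ⟶ M) :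
    toPhi X ≫ (Phi C).map φ ≫ g = rep.map φ.right ≫ toPhi Y ≫ g := by
  rw [← Category.assoc, toPhi_naturality, Category.assoc]

lemma rep_map_toPhi (X : Arrow C) : rep.map X.hom ≫ toPhi X = 0 :=
  ObjectProperty.hom_ext _ (cokernel.condition _)

lemma rep_map_toPhi_assoc (X : Arrow C) {M : FinPresFunctor C} (g : (Phi C).obj X ⟶ M) :
    rep.map X.hom ≫ toPhi X ≫ g = 0 ≫ g := by
  rw [← Category.assoc, rep_map_toPhi]

/-- Exactness of the presentation, evaluated at the identity of `W`. This turns equations in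
`mod(C)` into factorizations in `C`. -/
lemma rep_map_toPhi_eq_zero_iff {X : Arrow C} {W : C} (a : W ⟶ X.right) :
    rep.map a ≫ toPhi X = 0 ↔ ∃ b : W ⟶ X.left, b ≫ X.hom = a := by
  constructor
  · intro h
    have h' : (rep.map a ≫ toPhi X).hom.app (op W) (𝟙 W) = 0 := by rw [h]; rfl
    have h'' : (cokernel.π (preadditiveYoneda.map X.hom)).app (op W) a = 0 := by
      rw [← Category.id_comp a]
      exact h'
    exact exact_app (ShortComplex.exact_cokernel (preadditiveYoneda.map X.hom)) (op W) a h''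
  · rintro ⟨b, rfl⟩
    rw [rep.map_comp, Category.assoc, rep_map_toPhi, comp_zero]

lemma exists_rep_lift {X : Arrow C} {W : C} (x : rep.obj W ⟶ (Phi C).obj X) :
    ∃ a : W ⟶ X.right, rep.map a ≫ toPhi X = x := by
  obtain ⟨a, ha⟩ := rep.map_surjective (Projective.factorThru x (toPhi X))
  exact ⟨a, by rw [ha, Projective.factorThru_comp]⟩

lemma exists_iso_Phi (M : FinPresFunctor C) : ∃ X : Arrow C, Nonempty ((Phi C).obj X ≅ M) := by
  obtain ⟨C₁, C₀, f, π, w, h, he⟩ := M.property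
  refine ⟨Arrow.mk f, ⟨(FinPres C).isoMk ?_⟩⟩
  exact IsColimit.coconePointUniqueUpToIso (cokernelIsCokernel _) h.gIsCokernel

/-- Every object of `mod(C)` is a quotient of a representable functor. -/
lemma exists_epi_rep (M : FinPresFunctor C) : ∃ (W : C) (π : rep.obj W ⟶ M), Epi π := by
  obtain ⟨X, ⟨e⟩⟩ := exists_iso_Phi M
  exact ⟨X.right, toPhi X ≫ e.hom, epi_comp _ _⟩

/-- Representable functors cover every object, so exactness may be tested on their morphisms, which
amounts to testing on elements. -/
lemma exact_of_rep {S : ShortComplex (FinPresFunctor C)}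
    (h : ∀ (W : C) (x : rep.obj W ⟶ S.X₂), x ≫ S.g = 0 → ∃ y, y ≫ S.f = x) : S.Exact := by
  rw [ShortComplex.exact_iff_exact_up_to_refinements]
  intro A x hx
  obtain ⟨W, π, hπ⟩ := exists_epi_rep A
  obtain ⟨y, hy⟩ := h W (π ≫ x) (by rw [Category.assoc, hx, comp_zero])
  exact ⟨_, π, hπ, y, hy.symm⟩

lemma mono_of_rep {M N : FinPresFunctor C} (f : M ⟶ N)
    (h : ∀ (W : C) (x : rep.obj W ⟶ M), x ≫ f = 0 → x = 0) : Mono f := by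
  refine Preadditive.mono_of_cancel_zero f fun {A} x hx => ?_
  obtain ⟨W, π, hπ⟩ := exists_epi_rep A
  exact (cancel_epi π).1 ((h W (π ≫ x) (by rw [Category.assoc, hx, comp_zero])).trans
    comp_zero.symm)

lemma exact_toPhi (X : Arrow C) :
    (ShortComplex.mk (rep.map X.hom) (toPhi X) (rep_map_toPhi X)).Exact := by
  refine exact_of_rep fun W (x : rep.obj W ⟶ rep.obj X.right) hx => ?_
  obtain ⟨a, rfl⟩ := rep.map_surjective x
  obtain ⟨b, rfl⟩ := (rep_map_toPhi_eq_zero_iff a).1 hx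
  exact ⟨rep.map b, (rep.map_comp _ _).symm⟩

/-! ### The functor `Φ` -/

/-- Because `toPhi X` is epi, only the composite from the functor represented by `X.right` matters.
The kernel of `Phi` is thus the ideal of null-homotopic morphisms. -/
lemma Phi_map_eq_zero_iff {X Y : Arrow C} (φ : X ⟶ Y) :
    (Phi C).map φ = 0 ↔ ∃ s : X.right ⟶ Y.left, s ≫ Y.hom = φ.right := by
  rw [← rep_map_toPhi_eq_zero_iff, ← toPhi_naturality]
  exact ⟨fun h => by rw [h, comp_zero], fun h => (cancel_epi (toPhi X)).1 (h.trans comp_zero.symm)⟩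

instance : (Phi C).Additive where
  map_add {X Y f g} := by
    apply (cancel_epi (toPhi X)).1
    rw [Preadditive.comp_add, toPhi_naturality, toPhi_naturality, toPhi_naturality,
      ← Preadditive.add_comp, ← Functor.map_add]
    rfl

/-- A morphism of cokernels lifts to the presentations, first on targets and then on sources. -/
instance : (Phi C).Full where
  map_surjective {X Y} θ := by
    obtain ⟨a₀, h₀⟩ := exists_rep_lift (toPhi X ≫ θ)
    obtain ⟨a₁, h₁⟩ := (rep_map_toPhi_eq_zero_iff (X := Y) (X.hom ≫ a₀)).1 (by
      rw [rep.map_comp, Category.assoc, h₀, rep_map_toPhi_assoc, zero_comp])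
    refine ⟨Arrow.homMk a₁ a₀ h₁, (cancel_epi (toPhi X)).1 ?_⟩
    rw [toPhi_naturality, ← h₀]
    rfl

lemma Phi_map_eq_iff {X Y : Arrow C} (φ ψ : X ⟶ Y) :
    (Phi C).map φ = (Phi C).map ψ ↔ ∃ s : X.right ⟶ Y.left, s ≫ Y.hom = φ.right - ψ.right := by
  rw [← sub_eq_zero, ← Functor.map_sub, Phi_map_eq_zero_iff]
  rfl

lemma quotient_map_eq_iff_Phi {X Y : Arrow C} (φ ψ : X ⟶ Y) :
    (Preadditive.RightFreyd.quotient C).map φ = (Preadditive.RightFreyd.quotient C).map ψ ↔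
      (Phi C).map φ = (Phi C).map ψ := by
  rw [Preadditive.RightFreyd.quotient_map_eq_iff, Phi_map_eq_iff]
  exact ⟨fun ⟨h⟩ => ⟨h.hom, h.comm.symm⟩, fun ⟨s, h⟩ => ⟨⟨s, h.symm⟩⟩⟩

/-- Lift an isomorphism and its inverse through the full functor `F`; the composites agree with
identities after `F`, hence after `G`. It applies in both directions to `Phi` and the homotopy
quotient. -/
lemma nonempty_iso_of_map_eq {A D E : Type*} [Category* A] [Category* D] [Category* E]
    (F : A ⥤ D) (G : A ⥤ E) [F.Full]
    (h : ∀ {X Y : A} (φ ψ : X ⟶ Y), F.map φ = F.map ψ → G.map φ = G.map ψ) {X Y : A}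
    (e : F.obj X ≅ F.obj Y) : Nonempty (G.obj X ≅ G.obj Y) := by
  obtain ⟨φ, hφ⟩ := F.map_surjective e.hom
  obtain ⟨ψ, hψ⟩ := F.map_surjective e.inv
  refine ⟨⟨G.map φ, G.map ψ, ?_, ?_⟩⟩
  · rw [← G.map_comp, ← G.map_id]
    exact h _ _ (by rw [F.map_comp, hφ, hψ, e.hom_inv_id, F.map_id])
  · rw [← G.map_comp, ← G.map_id]
    exact h _ _ (by rw [F.map_comp, hφ, hψ, e.inv_hom_id, F.map_id])

lemma nonempty_quotient_iso_iff (X Y : Arrow C) :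
    Nonempty ((Preadditive.RightFreyd.quotient C).obj X ≅
      (Preadditive.RightFreyd.quotient C).obj Y) ↔ Nonempty ((Phi C).obj X ≅ (Phi C).obj Y) :=
  ⟨fun ⟨e⟩ => nonempty_iso_of_map_eq _ _ (fun φ ψ => (quotient_map_eq_iff_Phi φ ψ).1) e,
    fun ⟨e⟩ => nonempty_iso_of_map_eq _ _ (fun φ ψ => (quotient_map_eq_iff_Phi φ ψ).2) e⟩

lemma isHomotopyClosed_iff (T : ObjectProperty (Arrow C)) :
    IsHomotopyClosed T ↔ ∀ X Y, Nonempty ((Phi C).obj X ≅ (Phi C).obj Y) → T X → T Y := by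
  simp only [IsHomotopyClosed, nonempty_quotient_iso_iff]

/-- As `e` kills `X.hom`, it induces a morphism from the cokernel back to the representable functor;
as `e` is the identity modulo the image of `X.hom`, this morphism is a section of `toPhi X`. -/
lemma Phi_projective {X : Arrow C} (e : X.right ⟶ X.right) (s : X.right ⟶ X.left)
    (he : X.hom ≫ e = 0) (hs : e + s ≫ X.hom = 𝟙 _) : Projective ((Phi C).obj X) := by
  have hw : rep.map X.hom ≫ rep.map e = 0 := by rw [← rep.map_comp, he, rep.map_zero]
  let σ : (Phi C).obj X ⟶ rep.obj X.right := (exact_toPhi X).desc (rep.map e) hw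
  have hσ : toPhi X ≫ σ = rep.map e := (exact_toPhi X).g_desc (rep.map e) hw
  refine Retract.projective ⟨σ, toPhi X, (cancel_epi (toPhi X)).1 ?_⟩
  rw [← Category.assoc, hσ, Category.comp_id, eq_sub_of_add_eq hs, rep.map_sub, rep.map_id,
    Preadditive.sub_comp, Category.id_comp, rep.map_comp, Category.assoc, rep_map_toPhi,
    comp_zero, sub_zero]

lemma Phi_projective_of_isZero_left {X : Arrow C} (h : IsZero X.left) :
    Projective ((Phi C).obj X) :=
  Phi_projective (𝟙 _) 0 (h.eq_of_src _ _) (by simp)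

/-- The image of `coverHom X` is the summand `X.left` of the target, so `e` is the projection onto
`X.right` and `s` recovers the other summand. -/
instance (X : Arrow C) : Projective ((Phi C).obj (cover X)) :=
  Phi_projective (biprod.snd ≫ biprod.inr : X.left ⊞ X.right ⟶ X.left ⊞ X.right)
    (biprod.fst ≫ biprod.inr : X.left ⊞ X.right ⟶ kernel X.hom ⊞ X.left)
    (by simp [coverHom]) (by dsimp [coverHom]; ext <;> simp)

lemma nonempty_Phi_zeroTo_iso (A : C) :
    Nonempty ((Phi C).obj (zeroTo A) ≅ representable A) := by
  have h : IsIso (toPhi (zeroTo A)) := by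
    have : Mono (toPhi (zeroTo A)) := mono_of_rep _ fun W x hx => by
      obtain ⟨a, rfl⟩ := rep.map_surjective x
      obtain ⟨b, rfl⟩ := (rep_map_toPhi_eq_zero_iff a).1 hx
      exact (congrArg rep.map (comp_zero : b ≫ (0 : (0 : C) ⟶ A) = 0)).trans (rep.map_zero _ _)
    exact isIso_of_mono_of_epi _
  exact ⟨(asIso (toPhi (zeroTo A))).symm⟩

end

section

variable {C : Type u} [Category.{v} C] [Abelian C]

/-! ### `F`-exact sequences -/

namespace IsFExact

variable {S : ShortComplex (Arrow C)} (h : IsFExact S)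
include h

lemma exists_left : ∃ (r : S.X₂.left ⟶ S.X₁.left) (s : S.X₃.left ⟶ S.X₂.left),
    S.f.left ≫ r = 𝟙 _ ∧ s ≫ S.g.left = 𝟙 _ ∧ r ≫ S.f.left + S.g.left ≫ s = 𝟙 _ := by
  obtain ⟨σ⟩ := h.left
  exact ⟨σ.r, σ.s, σ.f_r, σ.s_g, σ.id⟩

lemma exists_right : ∃ (r : S.X₂.right ⟶ S.X₁.right) (s : S.X₃.right ⟶ S.X₂.right),
    S.f.right ≫ r = 𝟙 _ ∧ s ≫ S.g.right = 𝟙 _ ∧ r ≫ S.f.right + S.g.right ≫ s = 𝟙 _ := by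
  obtain ⟨σ⟩ := h.right
  exact ⟨σ.r, σ.s, σ.f_r, σ.s_g, σ.id⟩

lemma exists_kernel : ∃ s : kernel S.X₃.hom ⟶ kernel S.X₂.hom,
    s ≫ kernel.ι S.X₂.hom ≫ S.g.left = kernel.ι S.X₃.hom := by
  obtain ⟨σ⟩ := h.ker
  have hσ : σ.s ≫ (Limits.ker C).map S.g = 𝟙 (kernel S.X₃.hom) := σ.s_g
  have h' : (Limits.ker C).map S.g ≫ kernel.ι S.X₃.hom = kernel.ι S.X₂.hom ≫ S.g.left :=
    kernel.lift_ι _ _ _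
  refine ⟨σ.s, ?_⟩
  rw [← h']
  exact (Category.assoc _ _ _).symm.trans
    ((congrArg (· ≫ kernel.ι S.X₃.hom) hσ).trans (Category.id_comp _))

/-- With `exists_desc` and the mono and epi properties below, this makes an `F`-exact sequence a
kernel-cokernel pair: lift on each component by its splitting and check commutativity after a
monomorphism. -/
lemma exists_lift {W : Arrow C} (t : W ⟶ S.X₂) (ht : t ≫ S.g = 0) : ∃ u, u ≫ S.f = t := by
  obtain ⟨r₁, s₁, hr₁, -, h₁⟩ := h.exists_left
  obtain ⟨r₀, s₀, hr₀, -, h₀⟩ := h.exists_right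
  have hl : t.left ≫ S.g.left = 0 := congrArg CommaMorphism.left ht
  have hr : t.right ≫ S.g.right = 0 := congrArg CommaMorphism.right ht
  have e₁ : (t.left ≫ r₁) ≫ S.f.left = t.left := by
    rw [Category.assoc, eq_sub_of_add_eq h₁, Preadditive.comp_sub, Category.comp_id, reassoc_of% hl,
      zero_comp, sub_zero]
  have e₀ : (t.right ≫ r₀) ≫ S.f.right = t.right := by
    rw [Category.assoc, eq_sub_of_add_eq h₀, Preadditive.comp_sub, Category.comp_id, reassoc_of% hr,
      zero_comp, sub_zero]
  have : Mono S.f.right := mono_of_mono_fac hr₀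
  refine ⟨Arrow.homMk (t.left ≫ r₁) (t.right ≫ r₀) ?_, Arrow.hom_ext _ _ e₁ e₀⟩
  apply (cancel_mono S.f.right).1
  rw [Category.assoc, Category.assoc W.hom, e₀, ← Arrow.w S.f, ← Category.assoc _ S.f.left, e₁]
  exact Arrow.w t

lemma exists_desc {W : Arrow C} (t : S.X₂ ⟶ W) (ht : S.f ≫ t = 0) : ∃ u, S.g ≫ u = t := by
  obtain ⟨r₁, s₁, -, hs₁, h₁⟩ := h.exists_left
  obtain ⟨r₀, s₀, -, hs₀, h₀⟩ := h.exists_right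
  have hl : S.f.left ≫ t.left = 0 := congrArg CommaMorphism.left ht
  have hr : S.f.right ≫ t.right = 0 := congrArg CommaMorphism.right ht
  have e₁ : S.g.left ≫ s₁ ≫ t.left = t.left := by
    rw [← Category.assoc, eq_sub_of_add_eq' h₁, Preadditive.sub_comp, Category.id_comp,
      Category.assoc, hl, comp_zero, sub_zero]
  have e₀ : S.g.right ≫ s₀ ≫ t.right = t.right := by
    rw [← Category.assoc, eq_sub_of_add_eq' h₀, Preadditive.sub_comp, Category.id_comp,
      Category.assoc, hr, comp_zero, sub_zero]
  have : Epi S.g.left := epi_of_epi_fac hs₁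
  refine ⟨Arrow.homMk (s₁ ≫ t.left) (s₀ ≫ t.right) ?_, Arrow.hom_ext _ _ e₁ e₀⟩
  apply (cancel_epi S.g.left).1
  rw [← Category.assoc S.g.left, e₁, Arrow.w_assoc, e₀]
  exact Arrow.w t

lemma mono : Mono S.f := by
  obtain ⟨r₁, -, hr₁, -, -⟩ := h.exists_left
  obtain ⟨r₀, -, hr₀, -, -⟩ := h.exists_right
  have : Mono S.f.left := mono_of_mono_fac hr₁
  have : Mono S.f.right := mono_of_mono_fac hr₀
  exact ⟨fun a b hab => Arrow.hom_ext _ _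
    ((cancel_mono S.f.left).1 (congrArg CommaMorphism.left hab))
    ((cancel_mono S.f.right).1 (congrArg CommaMorphism.right hab))⟩

lemma epi : Epi S.g := by
  obtain ⟨-, s₁, -, hs₁, -⟩ := h.exists_left
  obtain ⟨-, s₀, -, hs₀, -⟩ := h.exists_right
  have : Epi S.g.left := epi_of_epi_fac hs₁
  have : Epi S.g.right := epi_of_epi_fac hs₀
  exact ⟨fun a b hab => Arrow.hom_ext _ _
    ((cancel_epi S.g.left).1 (congrArg CommaMorphism.left hab))
    ((cancel_epi S.g.right).1 (congrArg CommaMorphism.right hab))⟩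

lemma epi_Phi : Epi ((Phi C).map S.g) := by
  obtain ⟨-, s₀, -, hs₀, -⟩ := h.exists_right
  refine epi_of_epi_fac (f := rep.map s₀ ≫ toPhi S.X₂) (h := toPhi S.X₃) ?_
  rw [Category.assoc, toPhi_naturality, ← Category.assoc, ← rep.map_comp, hs₀, rep.map_id,
    Category.id_comp]

/-- The snake argument, and the point where the splitting of the kernel column is used. If the image
of `a` is a boundary `y ≫ S.X₂.hom`, then `y` maps into the kernel of `S.X₃.hom`; subtracting a lift
`y'` of this from `kernel S.X₂.hom` leaves the boundary unchanged and moves `y` into `S.X₁.left`. -/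
lemma mono_Phi : Mono ((Phi C).map S.f) := by
  obtain ⟨r₁, s₁, hr₁, hs₁, h₁⟩ := h.exists_left
  obtain ⟨r₀, s₀, hr₀, hs₀, h₀⟩ := h.exists_right
  obtain ⟨k, hk⟩ := h.exists_kernel
  have : Mono S.f.right := mono_of_mono_fac hr₀
  refine mono_of_rep _ fun W x hx => ?_
  obtain ⟨a, rfl⟩ := exists_rep_lift x
  rw [Category.assoc, toPhi_naturality, ← Category.assoc, ← rep.map_comp,
    rep_map_toPhi_eq_zero_iff] at hx
  obtain ⟨y, hy⟩ := hx
  have hz : (y ≫ S.g.left) ≫ S.X₃.hom = 0 := by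
    rw [Category.assoc, Arrow.w S.g, reassoc_of% hy, show S.f.right ≫ S.g.right = 0 from congrArg CommaMorphism.right S.zero,
      comp_zero]
  let y' : W ⟶ S.X₂.left := kernel.lift _ _ hz ≫ k ≫ kernel.ι S.X₂.hom
  have hy' : y' ≫ S.g.left = y ≫ S.g.left := by
    simp only [y', Category.assoc, hk, kernel.lift_ι]
  have hy'' : y' ≫ S.X₂.hom = 0 := by simp [y']
  refine (rep_map_toPhi_eq_zero_iff a).2 ⟨(y - y') ≫ r₁, ?_⟩
  apply (cancel_mono S.f.right).1
  have hd : ((y - y') ≫ r₁) ≫ S.f.left = y - y' := by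
    rw [Category.assoc, eq_sub_of_add_eq h₁, Preadditive.comp_sub, Category.comp_id,
      Preadditive.sub_comp y y' (S.g.left ≫ s₁), reassoc_of% hy', sub_self, sub_zero]
  rw [Category.assoc, ← Arrow.w S.f, ← Category.assoc _ S.f.left, hd, Preadditive.sub_comp, hy, hy'', sub_zero]

lemma exact_Phi : (S.map (Phi C)).Exact := by
  obtain ⟨r₁, s₁, hr₁, hs₁, h₁⟩ := h.exists_left
  obtain ⟨r₀, s₀, hr₀, hs₀, h₀⟩ := h.exists_right
  refine exact_of_rep fun W (x : _ ⟶ (Phi C).obj S.X₂) (hx : x ≫ (Phi C).map S.g = 0) => ?_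
  change ∃ y : _ ⟶ (Phi C).obj S.X₁, y ≫ (Phi C).map S.f = x
  obtain ⟨a, rfl⟩ := exists_rep_lift x
  rw [Category.assoc, toPhi_naturality, ← Category.assoc, ← rep.map_comp,
    rep_map_toPhi_eq_zero_iff] at hx
  obtain ⟨z, hz⟩ := hx
  -- The boundary of `z ≫ s₁` has the same image as `a` under `S.g.right`, so their difference comes
  -- from `S.X₁.right` through the retraction `r₀`.
  refine ⟨rep.map (a ≫ r₀ - z ≫ s₁ ≫ S.X₂.hom ≫ r₀) ≫ toPhi S.X₁, ?_⟩
  rw [Category.assoc, toPhi_naturality, ← Category.assoc, ← rep.map_comp]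
  have hd : (a ≫ r₀ - z ≫ s₁ ≫ S.X₂.hom ≫ r₀) ≫ S.f.right = a - (z ≫ s₁) ≫ S.X₂.hom := by
    have : (a ≫ r₀ - z ≫ s₁ ≫ S.X₂.hom ≫ r₀) = (a - (z ≫ s₁) ≫ S.X₂.hom) ≫ r₀ := by
      simp [Preadditive.sub_comp]
    rw [this, Category.assoc, eq_sub_of_add_eq h₀, Preadditive.comp_sub, Category.comp_id,
      ← Category.assoc _ S.g.right, Preadditive.sub_comp a, ← hz, Category.assoc, Category.assoc z,
      Category.assoc s₁, ← Arrow.w S.g, reassoc_of% hs₁, sub_self, zero_comp, sub_zero]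
  rw [hd, rep.map_sub, Preadditive.sub_comp, (rep_map_toPhi_eq_zero_iff _).2 ⟨_, rfl⟩, sub_zero]

lemma shortExact_Phi : (S.map (Phi C)).ShortExact :=
  .mk' h.exact_Phi h.mono_Phi h.epi_Phi

end IsFExact

end

section

/-! ### Dimension shifting -/

section

variable {A : Type*} [Category* A] [Abelian A] [HasExt.{v} A] {S : ShortComplex A}

/-- With a projective middle term, the long exact sequence makes `Ext¹(S.X₃, N)` the cokernel of
restriction along `S.f`. -/
lemma subsingleton_ext_one_iff (hS : S.ShortExact) [Projective S.X₂] (N : A) :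
    Subsingleton (Abelian.Ext.{v} S.X₃ N 1) ↔ ∀ θ : S.X₁ ⟶ N, ∃ η : S.X₂ ⟶ N, S.f ≫ η = θ := by
  constructor
  · intro h θ
    obtain ⟨x, hx⟩ := Abelian.Ext.contravariant_sequence_exact₁ hS N (Abelian.Ext.mk₀ θ)
      (add_zero 1) (Subsingleton.elim _ _)
    obtain ⟨η, rfl⟩ := Abelian.Ext.mk₀_bijective _ _ |>.2 x
    rw [Abelian.Ext.mk₀_comp_mk₀] at hx
    exact ⟨η, (Abelian.Ext.mk₀_bijective _ _).1 hx⟩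
  · intro h
    refine subsingleton_of_forall_eq 0 fun x => ?_
    obtain ⟨y, rfl⟩ := Abelian.Ext.contravariant_sequence_exact₃ hS N x
      (Abelian.Ext.eq_zero_of_projective _) (add_zero 1)
    obtain ⟨θ, rfl⟩ := Abelian.Ext.mk₀_bijective _ _ |>.2 y
    obtain ⟨η, rfl⟩ := h θ
    rw [← Abelian.Ext.mk₀_comp_mk₀, hS.extClass_comp_assoc]

lemma subsingleton_ext_succ_iff (hS : S.ShortExact) [Projective S.X₂] (N : A) (n : ℕ) :
    Subsingleton (Abelian.Ext.{v} S.X₃ N (n + 2)) ↔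
      Subsingleton (Abelian.Ext.{v} S.X₁ N (n + 1)) := by
  constructor
  · intro h
    refine subsingleton_of_forall_eq 0 fun x => ?_
    obtain ⟨y, rfl⟩ := Abelian.Ext.contravariant_sequence_exact₁ hS N x
      (n₁ := n + 2) (by omega) (Subsingleton.elim _ _)
    rw [Abelian.Ext.eq_zero_of_projective y, Abelian.Ext.comp_zero]
  · intro h
    refine subsingleton_of_forall_eq 0 fun x => ?_
    obtain ⟨y, rfl⟩ := Abelian.Ext.contravariant_sequence_exact₃ hS N x
      (Abelian.Ext.eq_zero_of_projective _) (n₀ := n + 1) (by omega)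
    rw [Subsingleton.elim y 0, Abelian.Ext.comp_zero]

end

variable {C : Type u} [Category.{v} C] [Abelian C]

/-! ### Comparison of relative projective resolutions -/

/-- Every map from the left term of a sequence to `Y` extends to the middle term. -/
def Extends (S : ShortComplex (Arrow C)) (Y : Arrow C) : Prop :=
  ∀ φ : S.X₁ ⟶ Y, ∃ ψ : S.X₂ ⟶ Y, S.f ≫ ψ = φ

/-- `Z'` is a direct summand of `Z` up to an `F`-projective object. -/
def IsStableRetract (Z' Z : Arrow C) : Prop :=
  ∃ (R : Arrow C) (k' : Z' ⟶ Z) (k : Z ⟶ Z') (a : Z' ⟶ R) (b : R ⟶ Z'),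
    IsFProjective R ∧ k' ≫ k + a ≫ b = 𝟙 Z'

/-- A form of Schanuel's lemma. Lift `k'`, `k` and `b` to the projective middle terms; the defect `𝟙
- l' ≫ l - S'.g ≫ a ≫ m` dies under `S'.g` and so factors as `t` through `S'.f`. On left terms this
reads `κ' ≫ κ + S'.f ≫ t = 𝟙`, which also shows how to extend a map: extend `κ ≫ φ` and correct by
`t`. It makes `ExtF` vanishing independent of the resolution. -/
lemma IsStableRetract.syzygy {S S' : ShortComplex (Arrow C)} (hS : IsFExact S)
    (hS' : IsFExact S') (hP : IsFProjective S.X₂) (hP' : IsFProjective S'.X₂)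
    (h : IsStableRetract S'.X₃ S.X₃) :
    IsStableRetract S'.X₁ S.X₁ ∧ ∀ Y, Extends S Y → Extends S' Y := by
  obtain ⟨R, k', k, a, b, hR, hk⟩ := h
  obtain ⟨l', hl'⟩ := hP' S hS (S'.g ≫ k')
  obtain ⟨l, hl⟩ := hP S' hS' (S.g ≫ k)
  obtain ⟨m, hm⟩ := hR S' hS' b
  obtain ⟨κ', hκ'⟩ := hS.exists_lift (S'.f ≫ l') (by rw [Category.assoc, hl', S'.zero_assoc,
    Limits.zero_comp])
  obtain ⟨κ, hκ⟩ := hS'.exists_lift (S.f ≫ l) (by rw [Category.assoc, hl, S.zero_assoc,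
    Limits.zero_comp])
  obtain ⟨t, ht⟩ := hS'.exists_lift (𝟙 _ - l' ≫ l - S'.g ≫ a ≫ m) (by
    simp only [Preadditive.sub_comp, Category.assoc, Category.id_comp, hl, hm]
    rw [← Category.assoc l', hl', Category.assoc, sub_sub, ← Preadditive.comp_add, hk,
      Category.comp_id, sub_self])
  have := hS'.mono
  have e : κ' ≫ κ + S'.f ≫ t = 𝟙 _ := by
    apply (cancel_mono S'.f).1
    rw [Preadditive.add_comp, Category.assoc, hκ, ← Category.assoc κ', hκ', Category.assoc S'.f t,
      ht, Category.assoc]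
    simp only [Preadditive.comp_sub, Category.comp_id, S'.zero_assoc, Limits.zero_comp, sub_zero,
      Category.id_comp]
    abel
  refine ⟨⟨S'.X₂, κ', κ, S'.f, t, hP', e⟩, fun Y hY φ => ?_⟩
  obtain ⟨ψ, hψ⟩ := hY (κ ≫ φ)
  refine ⟨l' ≫ ψ + t ≫ φ, ?_⟩
  rw [Preadditive.comp_add, ← Category.assoc, ← hκ', Category.assoc, hψ, ← Category.assoc,
    ← Category.assoc S'.f, ← Preadditive.add_comp, e, Category.id_comp]

namespace FProjectiveResolution

variable {X : Arrow C}

/-- The `n`-th `F`-exact sequence of a relative projective resolution. -/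
abbrev seq (P : FProjectiveResolution X) (n : ℕ) : ShortComplex (Arrow C) :=
  ShortComplex.mk (P.ι n) (P.π n) (P.w n)

lemma isStableRetract_syz (P Q : FProjectiveResolution X) (n : ℕ) :
    IsStableRetract (Q.syz n) (P.syz n) := by
  induction n with
  | zero =>
    exact ⟨cover X, Q.iso.hom ≫ P.iso.inv, P.iso.hom ≫ Q.iso.inv, 0, 0, cover_fproj X, by simp⟩
  | succ n ih =>
    exact (IsStableRetract.syzygy (S := P.seq n) (S' := Q.seq n) (P.fexact n) (Q.fexact n)
      (P.fproj n) (Q.fproj n) ih).1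

lemma extends_seq_of_extends_seq (P Q : FProjectiveResolution X) (n : ℕ) (Y : Arrow C)
    (h : Extends (P.seq n) Y) : Extends (Q.seq n) Y :=
  (IsStableRetract.syzygy (S := P.seq n) (S' := Q.seq n) (P.fexact n) (Q.fexact n)
    (P.fproj n) (Q.fproj n) (isStableRetract_syz P Q n)).2 Y h

/-- Cocycles in degree `n + 1` are the maps out of `P.syz (n + 1)`, and coboundaries are those that
extend along `P.ι n`. -/
lemma subsingleton_cohomology_iff (P : FProjectiveResolution X) (Y : Arrow C) (n : ℕ) :
    Subsingleton (P.cohomology Y (n + 1)) ↔ Extends (P.seq n) Y := by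
  have hepi : ∀ n, Epi (P.π n) := fun n => (P.fexact n).epi
  rw [QuotientAddGroup.subsingleton_iff, AddSubgroup.addSubgroupOf_eq_top]
  constructor
  · intro h φ
    have hφ : P.π (n + 1) ≫ φ ∈ P.cocycles Y (n + 1) := by
      change (P.π (n + 2) ≫ P.ι (n + 1)) ≫ P.π (n + 1) ≫ φ = 0
      rw [Category.assoc, ← Category.assoc (P.ι (n + 1)), P.w (n + 1), zero_comp, comp_zero]
    obtain ⟨b, hb⟩ := h hφ
    refine ⟨b, (cancel_epi (P.π (n + 1))).1 ?_⟩
    rw [← Category.assoc]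
    exact hb
  · intro h c hc
    have hc' : (P.π (n + 2) ≫ P.ι (n + 1)) ≫ c = 0 := hc
    rw [Category.assoc] at hc'
    obtain ⟨φ, hφ⟩ := (P.fexact (n + 1)).exists_desc c
      ((cancel_epi (P.π (n + 2))).1 (hc'.trans comp_zero.symm))
    obtain ⟨b, hb⟩ := h φ
    refine ⟨b, ?_⟩
    change (P.π (n + 1) ≫ P.ι n) ≫ b = c
    rw [← hφ, ← hb, Category.assoc]

end FProjectiveResolution

/-- The iterated syzygies of a map. -/
def iterSyzygy (X : Arrow C) : ℕ → Arrow C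
  | 0 => X
  | n + 1 => syzygy (iterSyzygy X n)

/-- The `F`-exact sequence that ends in the cover of `X`. -/
abbrev coverSeq (X : Arrow C) : ShortComplex (Arrow C) :=
  ShortComplex.mk (syzygyι X) (coverπ X) (syzygyι_coverπ X)

/-- The resolution of `X` by the covers of its iterated syzygies. -/
def coverResolution (X : Arrow C) : FProjectiveResolution X where
  obj n := cover (iterSyzygy X n)
  syz := iterSyzygy X
  ι n := syzygyι (iterSyzygy X n)
  π n := coverπ (iterSyzygy X n)
  w n := syzygyι_coverπ (iterSyzygy X n)
  fexact n := cover_fexact (iterSyzygy X n)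
  fproj n := cover_fproj (iterSyzygy X n)
  iso := Iso.refl _

lemma subsingleton_extF_iff_extends (X Y : Arrow C) (n : ℕ) :
    Subsingleton (ExtF X Y (n + 1)) ↔ Extends (coverSeq (iterSyzygy X n)) Y :=
  (FProjectiveResolution.subsingleton_cohomology_iff _ Y n).trans
    ⟨FProjectiveResolution.extends_seq_of_extends_seq _ (coverResolution X) n Y,
      FProjectiveResolution.extends_seq_of_extends_seq (coverResolution X) _ n Y⟩

/-! ### Comparison of `Ext_F` with `Ext` in `mod(C)` -/

/-- This compensates for `Phi` not being faithful: a morphism that `Phi` kills already extends over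
the cover, strictly and not only up to homotopy. -/
lemma extends_coverSeq_of_rightHomotopy (X : Arrow C) {Y : Arrow C} (φ : syzygy X ⟶ Y)
    (s : X.left ⟶ Y.left) (hs : s ≫ Y.hom = φ.right) :
    ∃ ψ : cover X ⟶ Y, syzygyι X ≫ ψ = φ := by
  let φl : kernel X.hom ⟶ Y.left := φ.left
  let φr : X.left ⟶ Y.right := φ.right
  have hs' : s ≫ Y.hom = φr := hs
  have hφ : φl ≫ Y.hom = kernel.ι X.hom ≫ φr := Arrow.w φ
  -- The first entry is forced by the sign in `syzygyι`: `-(ι ≫ s - φl) + ι ≫ s = φl`. It composes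
  -- to zero with `Y.hom`, as `coverHom X` demands on this summand.
  let ψl : kernel X.hom ⊞ X.left ⟶ Y.left := biprod.desc (kernel.ι X.hom ≫ s - φl) s
  let ψr : X.left ⊞ X.right ⟶ Y.right := biprod.desc φr 0
  have hψ : ψl ≫ Y.hom = coverHom X ≫ ψr := by
    dsimp only [coverHom, ψl, ψr]
    ext
    · simp [hs', hφ]
    · simp [hs']
  have hl : (biprod.lift (-(𝟙 (kernel X.hom))) (kernel.ι X.hom) :
      kernel X.hom ⟶ kernel X.hom ⊞ X.left) ≫ ψl = φl := by simp [ψl]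
  have hr : (biprod.lift (𝟙 X.left) (-X.hom) : X.left ⟶ X.left ⊞ X.right) ≫ ψr = φr := by
    simp [ψr]
  exact ⟨Arrow.homMk ψl ψr hψ, Arrow.hom_ext _ _ hl hr⟩

lemma shortExact_Phi_coverSeq (X : Arrow C) : ((coverSeq X).map (Phi C)).ShortExact :=
  (cover_fexact X).shortExact_Phi

instance (X : Arrow C) : Projective ((coverSeq X).map (Phi C)).X₂ :=
  inferInstanceAs (Projective ((Phi C).obj (cover X)))

/-- Fullness lifts an extension in `mod(C)` to one that is correct up to homotopy, and the
null-homotopic error extends by the preceding lemma. -/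
lemma extends_coverSeq_iff (X Y : Arrow C) :
    Extends (coverSeq X) Y ↔ Subsingleton (Abelian.Ext ((Phi C).obj X) ((Phi C).obj Y) 1) := by
  refine Iff.trans ?_ (subsingleton_ext_one_iff (shortExact_Phi_coverSeq X) _).symm
  constructor
  · intro h θ
    obtain ⟨φ, rfl⟩ := (Phi C).map_surjective (X := syzygy X) θ
    obtain ⟨ψ, rfl⟩ := h φ
    exact ⟨(Phi C).map ψ, ((Phi C).map_comp _ _).symm⟩
  · intro h (φ : syzygy X ⟶ Y)
    obtain ⟨η, hη⟩ := h ((Phi C).map φ)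
    obtain ⟨ψ, rfl⟩ := (Phi C).map_surjective (X := cover X) η
    have hψ : (Phi C).map φ = (Phi C).map (syzygyι X ≫ ψ) :=
      hη.symm.trans ((Phi C).map_comp _ _).symm
    obtain ⟨s, hs⟩ := (Phi_map_eq_iff _ _).1 hψ
    obtain ⟨χ, hχ⟩ := extends_coverSeq_of_rightHomotopy X (φ - syzygyι X ≫ ψ) s hs
    exact ⟨χ + ψ, by rw [Preadditive.comp_add]; exact (congrArg (· + _) hχ).trans (by simp)⟩

lemma subsingleton_ext_iterSyzygy_iff (X : Arrow C) (N : FinPresFunctor C) (n k : ℕ) :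
    Subsingleton (Abelian.Ext ((Phi C).obj (iterSyzygy X n)) N (k + 1)) ↔
      Subsingleton (Abelian.Ext ((Phi C).obj X) N (k + n + 1)) := by
  induction n generalizing k with
  | zero => rfl
  | succ n ih =>
    refine (subsingleton_ext_succ_iff (shortExact_Phi_coverSeq (iterSyzygy X n)) N k).symm.trans ?_
    rw [show k + (n + 1) + 1 = k + 1 + n + 1 by omega]
    exact ih (k + 1)

/-- `Φ` preserves and reflects the vanishing of extension groups in positive degrees. -/
lemma subsingleton_extF_iff (X Y : Arrow C) {k : ℕ} (hk : 1 ≤ k) :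
    Subsingleton (ExtF X Y k) ↔
      Subsingleton (Abelian.Ext ((Phi C).obj X) ((Phi C).obj Y) k) := by
  obtain ⟨n, rfl⟩ := Nat.exists_eq_add_of_le' hk
  rw [subsingleton_extF_iff_extends, extends_coverSeq_iff,
    subsingleton_ext_iterSyzygy_iff X ((Phi C).obj Y) n 0, Nat.zero_add]

/-! ### Projective dimension -/

lemma isZero_left_syzygy_syzygy (X : Arrow C) : IsZero (syzygy (syzygy X)).left :=
  IsZero.of_iso (isZero_zero C) (kernel.ofMono (kernel.ι X.hom))

/-- The second syzygy has as source the kernel of a monomorphism, which is zero. A map with zero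
source lifts along an `F`-exact sequence by splitting the targets alone. -/
lemma relProjDimLE_two (X : Arrow C) : RelProjDimLE 2 X := by
  refine ⟨_, _, _, _, _, cover_fproj X, cover_fexact X, _, _, _, _, _, cover_fproj (syzygy X),
    cover_fexact (syzygy X), fun S hS f => ?_⟩
  have hz := isZero_left_syzygy_syzygy X
  obtain ⟨-, s, -, hs, -⟩ := hS.exists_right
  exact ⟨Arrow.homMk 0 (f.right ≫ s) (hz.eq_of_src _ _), Arrow.hom_ext _ _ (hz.eq_of_src _ _)
    ((Category.assoc _ _ _).trans ((congrArg (_ ≫ ·) hs).trans (Category.comp_id _)))⟩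

lemma hasProjectiveDimensionLE_two (M : FinPresFunctor C) : HasProjectiveDimensionLE M 2 := by
  obtain ⟨X, ⟨e⟩⟩ := exists_iso_Phi M
  have := Phi_projective_of_isZero_left (isZero_left_syzygy_syzygy X)
  -- Projective means dimension less than one, and each cover sequence raises the strict bound by
  -- one, ending at three.
  have h₁ := ((shortExact_Phi_coverSeq (syzygy X)).hasProjectiveDimensionLT_X₃_iff 0
    inferInstance).2 (projective_iff_hasProjectiveDimensionLT_one.1 this)
  have h₀ := ((shortExact_Phi_coverSeq X).hasProjectiveDimensionLT_X₃_iff 1 inferInstance).2 h₁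
  have h : HasProjectiveDimensionLT ((Phi C).obj X) 3 := h₀
  exact hasProjectiveDimensionLT_of_iso e 3

lemma subsingleton_ext_of_three_le (M N : FinPresFunctor C) {k : ℕ} (hk : 3 ≤ k) :
    Subsingleton (Abelian.Ext M N k) :=
  have := hasProjectiveDimensionLE_two M
  HasProjectiveDimensionLT.subsingleton M 3 k hk N

/-- An `F`-exact sequence whose extension group vanishes splits. -/
lemma IsFExact.nonempty_retract {S : ShortComplex (Arrow C)} (hS : IsFExact S)
    (h : Subsingleton (Abelian.Ext ((Phi C).obj S.X₃) ((Phi C).obj S.X₁) 1)) :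
    Nonempty (Retract S.X₁ S.X₂) := by
  -- The sequence is compared with the cover sequence of `S.X₃`, with `φ` between the left terms. An
  -- extension `ψ` of `φ` corrects `l` to `l - ψ ≫ S.f`, which descends to a section of `S.g`.
  obtain ⟨l, hl⟩ := cover_fproj S.X₃ S hS (coverπ S.X₃)
  obtain ⟨φ, hφ⟩ := hS.exists_lift (syzygyι S.X₃ ≫ l) (by
    rw [Category.assoc, hl, syzygyι_coverπ])
  obtain ⟨ψ, hψ⟩ := (extends_coverSeq_iff _ _).2 h φ
  have hψ' : syzygyι S.X₃ ≫ ψ = φ := hψ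
  obtain ⟨s, hs⟩ := (cover_fexact S.X₃).exists_desc (l - ψ ≫ S.f) (by
    change syzygyι S.X₃ ≫ _ = 0
    rw [Preadditive.comp_sub, ← Category.assoc, hψ', hφ, sub_self])
  have hs' : coverπ S.X₃ ≫ s = l - ψ ≫ S.f := hs
  have := (cover_fexact S.X₃).epi
  have := hS.mono
  have hsg : s ≫ S.g = 𝟙 _ := by
    apply (cancel_epi (coverπ S.X₃)).1
    rw [← Category.assoc, hs', Preadditive.sub_comp, hl, Category.assoc, S.zero, comp_zero,
      sub_zero, Category.comp_id]
  obtain ⟨r, hr⟩ := hS.exists_lift (𝟙 _ - S.g ≫ s) (by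
    rw [Preadditive.sub_comp, Category.assoc, hsg, Category.comp_id, Category.id_comp, sub_self])
  refine ⟨⟨S.f, r, (cancel_mono S.f).1 ?_⟩⟩
  rw [Category.assoc, hr, Preadditive.comp_sub, ← Category.assoc, S.zero, zero_comp, sub_zero,
    Category.comp_id, Category.id_comp]

end

section

variable {C : Type u} [Category.{v} C] [Abelian C]

/-! ### Lifting exact sequences along `Φ` -/

section Extension

variable {X Z : Arrow C} (α : Z.left ⟶ X.right)

/-- The extension of `Z` by `X` given by a morphism from the source of `Z` to the target of `X`. -/
abbrev extension : Arrow C :=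
  Arrow.mk (biprod.desc (X.hom ≫ biprod.inl) (Z.hom ≫ biprod.inr - α ≫ biprod.inl) :
    X.left ⊞ Z.left ⟶ X.right ⊞ Z.right)

/-- The inclusion into an extension. -/
def extensionι : X ⟶ extension α :=
  Arrow.homMk (biprod.inl : X.left ⟶ X.left ⊞ Z.left) (biprod.inl : X.right ⟶ X.right ⊞ Z.right)
    (by simp)

/-- The projection from an extension. -/
def extensionπ : extension α ⟶ Z :=
  Arrow.homMk (biprod.snd : X.left ⊞ Z.left ⟶ Z.left) (biprod.snd : X.right ⊞ Z.right ⟶ Z.right)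
    (by dsimp; ext <;> simp)

lemma extensionι_π : extensionι α ≫ extensionπ α = 0 :=
  Arrow.hom_ext _ _ (biprod.inl_snd : (biprod.inl : X.left ⟶ X.left ⊞ Z.left) ≫ _ = 0)
    (biprod.inl_snd : (biprod.inl : X.right ⟶ X.right ⊞ Z.right) ≫ _ = 0)

lemma kernel_extension_snd : (kernel.ι (extension α).hom ≫ biprod.snd) ≫ Z.hom = 0 := by
  have h := kernel.condition (extension α).hom =≫ (biprod.snd : X.right ⊞ Z.right ⟶ Z.right)
  rw [zero_comp] at h
  rw [← h, Category.assoc, Category.assoc]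
  congr 1
  dsimp
  ext <;> simp

lemma kernel_extension_fst : kernel.ι (extension α).hom ≫ biprod.fst ≫ X.hom =
    kernel.ι (extension α).hom ≫ biprod.snd ≫ α := by
  have h := kernel.condition (extension α).hom =≫ (biprod.fst : X.right ⊞ Z.right ⟶ X.right)
  rw [zero_comp, Category.assoc] at h
  rw [← sub_eq_zero, ← Preadditive.comp_sub, ← h]
  congr 1
  dsimp
  ext <;> simp

/-- Sources and targets are direct sums, so only the kernels need care: `(β, kernel.ι Z.hom)` lands
in the kernel of the extension and splits that column. -/
lemma extension_fexact (β : kernel Z.hom ⟶ X.left) (h : β ≫ X.hom = kernel.ι Z.hom ≫ α) :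
    IsFExact (ShortComplex.mk (extensionι α) (extensionπ α) (extensionι_π α)) where
  left := ⟨ShortComplex.Splitting.ofHasBinaryBiproduct X.left Z.left⟩
  right := ⟨ShortComplex.Splitting.ofHasBinaryBiproduct X.right Z.right⟩
  ker := by
    let E := extension α
    let q : kernel E.hom ⟶ kernel Z.hom :=
      kernel.lift _ (kernel.ι E.hom ≫ biprod.snd) (kernel_extension_snd α)
    have hq : q ≫ kernel.ι Z.hom = kernel.ι E.hom ≫ biprod.snd := kernel.lift_ι _ _ _
    let j : kernel X.hom ⟶ kernel E.hom :=
      kernel.lift _ (kernel.ι X.hom ≫ biprod.inl) (by simp [E])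
    have hj : j ≫ kernel.ι E.hom = kernel.ι X.hom ≫ biprod.inl := kernel.lift_ι _ _ _
    let r : kernel E.hom ⟶ kernel X.hom :=
      kernel.lift _ (kernel.ι E.hom ≫ biprod.fst - q ≫ β) (by
        rw [Preadditive.sub_comp, Category.assoc, Category.assoc, h, reassoc_of% hq,
          kernel_extension_fst, sub_self])
    have hr : r ≫ kernel.ι X.hom = kernel.ι E.hom ≫ biprod.fst - q ≫ β := kernel.lift_ι _ _ _
    let s : kernel Z.hom ⟶ kernel E.hom :=
      kernel.lift _ (biprod.lift β (kernel.ι Z.hom)) (by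
        simp [E, biprod.lift_desc, reassoc_of% h])
    have hs : s ≫ kernel.ι E.hom = biprod.lift β (kernel.ι Z.hom) := kernel.lift_ι _ _ _
    have hjq : j ≫ q = 0 := by
      apply (cancel_mono (kernel.ι Z.hom)).1
      rw [Category.assoc, hq, reassoc_of% hj, biprod.inl_snd, comp_zero, zero_comp]
    have hjr : j ≫ r = 𝟙 _ := by
      apply (cancel_mono (kernel.ι X.hom)).1
      rw [Category.assoc, hr, Preadditive.comp_sub, reassoc_of% hj, reassoc_of% hjq, zero_comp,
        biprod.inl_fst, Category.comp_id, sub_zero, Category.id_comp]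
    have hsq : s ≫ q = 𝟙 _ := by
      apply (cancel_mono (kernel.ι Z.hom)).1
      rw [Category.assoc, hq, reassoc_of% hs, biprod.lift_snd, Category.id_comp]
    have hid : r ≫ j + q ≫ s = 𝟙 _ := by
      apply (cancel_mono (kernel.ι E.hom)).1
      rw [Preadditive.add_comp, Category.assoc, hj, reassoc_of% hr, Category.assoc, hs,
        Category.id_comp]
      apply biprod.hom_ext
      · simp
      · simp [hq]
    exact ⟨{ r := r, s := s, f_r := hjr, s_g := hsq, id := hid }⟩

end Extension

/-- Presentations of the outer terms of a short exact sequence in `mod(C)` extend to an `F`-exact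
sequence that lifts it. -/
lemma exists_fexact_lift {S : ShortComplex (FinPresFunctor C)} (hS : S.ShortExact)
    {X Z : Arrow C} (e₁ : (Phi C).obj X ≅ S.X₁) (e₃ : (Phi C).obj Z ≅ S.X₃) :
    ∃ (Y : Arrow C) (i : X ⟶ Y) (p : Y ⟶ Z) (w : i ≫ p = 0),
      IsFExact (ShortComplex.mk i p w) ∧ Nonempty ((Phi C).obj Y ≅ S.X₂) := by
  have := hS.epi_g
  have := hS.mono_f
  -- The horseshoe construction: `l` lifts the generators of `S.X₃`, and the relations of `Z` carry
  -- it into `S.X₁`, where the result is represented by `α`.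
  let l : rep.obj Z.right ⟶ S.X₂ := Projective.factorThru (toPhi Z ≫ e₃.hom) S.g
  have hl : l ≫ S.g = toPhi Z ≫ e₃.hom := Projective.factorThru_comp _ _
  have hl' : (rep.map Z.hom ≫ l) ≫ S.g = 0 := by
    rw [Category.assoc, hl, rep_map_toPhi_assoc, zero_comp]
  let κ : rep.obj Z.left ⟶ S.X₁ := hS.exact.lift _ hl'
  have hκ : κ ≫ S.f = rep.map Z.hom ≫ l := hS.exact.lift_f _ hl'
  obtain ⟨α, hα⟩ := exists_rep_lift (κ ≫ e₁.inv)
  -- On `kernel Z.hom` the relations vanish, so `α` becomes zero in `Φ(X)` there; `β` witnesses this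
  -- and makes the extension `F`-exact.
  obtain ⟨β, hβ⟩ := (rep_map_toPhi_eq_zero_iff (X := X) (kernel.ι Z.hom ≫ α)).1 (by
    apply (cancel_mono (e₁.hom ≫ S.f)).1
    rw [rep.map_comp, Category.assoc (rep.map _), hα, Category.assoc, Category.assoc,
      e₁.inv_hom_id_assoc, hκ, ← Category.assoc, ← rep.map_comp, kernel.condition, rep.map_zero, zero_comp, zero_comp])
  have hE := extension_fexact α β hβ
  refine ⟨_, _, _, _, hE, ?_⟩
  -- The sign of `α` in `extension` makes `m` kill the relations; the induced `μ` fits between the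
  -- outer isomorphisms and is an isomorphism by the five lemma.
  let m : rep.obj (X.right ⊞ Z.right) ⟶ S.X₂ :=
    rep.map biprod.fst ≫ toPhi X ≫ e₁.hom ≫ S.f + rep.map biprod.snd ≫ l
  have hm : rep.map (extension α).hom ≫ m = 0 := by
    have h₁ : (extension α).hom ≫ (biprod.fst : X.right ⊞ Z.right ⟶ X.right) =
        biprod.fst ≫ X.hom - biprod.snd ≫ α := by dsimp; ext <;> simp
    have h₂ : (extension α).hom ≫ (biprod.snd : X.right ⊞ Z.right ⟶ Z.right) =
        biprod.snd ≫ Z.hom := by dsimp; ext <;> simp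
    have hα' : rep.map α ≫ toPhi X ≫ e₁.hom ≫ S.f = rep.map Z.hom ≫ l := by
      rw [reassoc_of% hα, e₁.inv_hom_id_assoc, hκ]
    dsimp only [m]
    rw [Preadditive.comp_add, ← Category.assoc, ← rep.map_comp, ← Category.assoc (rep.map _)
      (rep.map biprod.snd), ← rep.map_comp, h₁, h₂, rep.map_sub, Preadditive.sub_comp,
      rep.map_comp, rep.map_comp, rep.map_comp, Category.assoc, Category.assoc, Category.assoc,
      hα', rep_map_toPhi_assoc, zero_comp, comp_zero, zero_sub, neg_add_cancel]
  let μ : (Phi C).obj (extension α) ⟶ S.X₂ := (exact_toPhi (extension α)).desc m hm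
  have hμ : toPhi (extension α) ≫ μ = m := (exact_toPhi (extension α)).g_desc m hm
  have h₁ : (Phi C).map (extensionι α) ≫ μ = e₁.hom ≫ S.f := by
    apply (cancel_epi (toPhi X)).1
    rw [toPhi_naturality_assoc, hμ]
    change rep.map biprod.inl ≫ (_ + _) = _
    rw [Preadditive.comp_add, ← Category.assoc, ← rep.map_comp, ← Category.assoc (rep.map _)
      (rep.map biprod.snd), ← rep.map_comp, biprod.inl_fst, biprod.inl_snd, rep.map_zero,
      rep.map_id, zero_comp, Category.id_comp, add_zero]
  have h₂ : μ ≫ S.g = (Phi C).map (extensionπ α) ≫ e₃.hom := by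
    apply (cancel_epi (toPhi (extension α))).1
    rw [toPhi_naturality_assoc, reassoc_of% hμ]
    change (_ + _) ≫ _ = rep.map biprod.snd ≫ _
    simp only [Preadditive.add_comp, Category.assoc, S.zero, comp_zero, zero_add, hl]
  let φ : (ShortComplex.mk _ _ (extensionι_π α)).map (Phi C) ⟶ S :=
    { τ₁ := e₁.hom, τ₂ := μ, τ₃ := e₃.hom, comm₁₂ := h₁.symm, comm₂₃ := h₂ }
  have : IsIso φ.τ₁ := inferInstanceAs (IsIso e₁.hom)
  have : IsIso φ.τ₃ := inferInstanceAs (IsIso e₃.hom)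
  have : IsIso μ := ShortComplex.isIso₂_of_shortExact_of_isIso₁₃ φ hE.shortExact_Phi hS
  exact ⟨asIso μ⟩

/-! ### Coresolutions -/

lemma HasCoresolution.of_iso {A : Type*} [Category* A] [Abelian A] {T : ObjectProperty A}
    [T.IsClosedUnderIsomorphisms] {n : ℕ} {M N : A} (h : HasCoresolution T n M) (e : M ≅ N) :
    HasCoresolution T n N := by
  cases n with
  | zero => exact T.prop_of_iso e h
  | succ n =>
    obtain ⟨T₀, K, i, p, w, hT, hS, hK⟩ := h
    refine ⟨T₀, K, e.inv ≫ i, p, by rw [Category.assoc, w, comp_zero], hT, ?_, hK⟩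
    let e' : ShortComplex.mk i p w ≅ ShortComplex.mk (e.inv ≫ i) p
        (by rw [Category.assoc, w, comp_zero]) :=
      ShortComplex.isoMk e (Iso.refl _) (Iso.refl _) (by simp) (by simp)
    exact ShortComplex.shortExact_of_iso e' hS

lemma HasRelCoresolution.map_Phi {T : ObjectProperty (Arrow C)} {n : ℕ} {X : Arrow C}
    (h : HasRelCoresolution T n X) : HasCoresolution (T.map (Phi C)) n ((Phi C).obj X) := by
  induction n generalizing X with
  | zero => exact ⟨X, h, ⟨Iso.refl _⟩⟩
  | succ n ih =>
    obtain ⟨T₀, K, i, p, w, hT, hS, hK⟩ := h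
    exact ⟨_, _, _, _, _, ⟨T₀, hT, ⟨Iso.refl _⟩⟩, hS.shortExact_Phi, ih hK⟩

/-- The sequences are lifted one by one; the presentation chosen for a cokernel becomes the
prescribed left term of the next one. -/
lemma HasCoresolution.lift_Phi {T : ObjectProperty (FinPresFunctor C)}
    [T.IsClosedUnderIsomorphisms] {n : ℕ} {M : FinPresFunctor C} (h : HasCoresolution T n M)
    {X : Arrow C} (e : (Phi C).obj X ≅ M) : HasRelCoresolution (T.inverseImage (Phi C)) n X := by
  induction n generalizing M X with
  | zero => exact T.prop_of_iso e.symm h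
  | succ n ih =>
    obtain ⟨T₀, K, i, p, w, hT, hS, hK⟩ := h
    obtain ⟨Z, ⟨e₃⟩⟩ := exists_iso_Phi K
    obtain ⟨Y, i', p', w', hF, ⟨e₂⟩⟩ := exists_fexact_lift hS e e₃
    exact ⟨Y, Z, i', p', w', T.prop_of_iso e₂.symm hT, hF, ih hK e₃⟩

lemma IsFExact.of_isZero (X : Arrow C) {Z : Arrow C} (hZ : IsZero Z) :
    IsFExact (ShortComplex.mk (𝟙 X) (0 : X ⟶ Z) comp_zero) := by
  have h (G : Arrow C ⥤ C) [G.PreservesZeroMorphisms] :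
      Nonempty ((ShortComplex.mk (𝟙 X) (0 : X ⟶ Z) comp_zero).map G).Splitting :=
    ⟨{ r := 𝟙 _
       s := 0
       f_r := (Category.comp_id _).trans (G.map_id X)
       s_g := (G.map_isZero hZ).eq_of_src _ _
       id := by
        rw [comp_zero, add_zero]
        exact (Category.id_comp _).trans (G.map_id X) }⟩
  exact ⟨h _, h _, h _⟩

end

section

/-! ### Additive subcategories -/

section

variable {D : Type*} [Category* D] [Preadditive D] [HasBinaryBiproducts D] [HasZeroObject D]
  [HasFiniteProducts D] {P : ObjectProperty D}

lemma isClosedUnderFiniteProducts_of_biprod [P.IsClosedUnderIsomorphisms] (hz : P 0)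
    (h : ∀ X Y, P X → P Y → P (X ⊞ Y)) : P.IsClosedUnderFiniteProducts := by
  have : P.ContainsZero := ⟨⟨0, isZero_zero _, hz⟩⟩
  have : P.IsClosedUnderBinaryProducts := by
    refine ⟨?_⟩
    rintro X ⟨p⟩
    refine P.prop_of_iso ?_ (h _ _ (p.prop_diag_obj ⟨WalkingPair.left⟩)
      (p.prop_diag_obj ⟨WalkingPair.right⟩))
    exact (biprod.isoProd _ _) ≪≫
      IsLimit.conePointsIsoOfNatIso (limit.isLimit (pair _ _)) p.isLimit
        (Discrete.natIso (by rintro ⟨_ | _⟩ <;> exact Iso.refl _))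
  exact .mk'

omit [Preadditive D] [HasBinaryBiproducts D] [HasZeroObject D] [HasFiniteProducts D] in
lemma IsAdditiveSubcategory.isClosedUnderIsomorphisms (h : IsAdditiveSubcategory P) :
    P.IsClosedUnderIsomorphisms :=
  have := h.closedUnderSummands
  inferInstance

omit [Preadditive D] [HasBinaryBiproducts D] [HasZeroObject D] in
lemma IsAdditiveSubcategory.zero (h : IsAdditiveSubcategory P) {Z : D} (hZ : IsZero Z) : P Z := by
  have := h.closedUnderSums
  have := h.isClosedUnderIsomorphisms
  exact P.prop_of_iso (terminalIsTerminal.uniqueUpToIso hZ.isTerminal) P.prop_terminal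

omit [HasZeroObject D] [HasFiniteProducts D] in
lemma IsAdditiveSubcategory.biprod (h : IsAdditiveSubcategory P) {X Y : D} (hX : P X) (hY : P Y) :
    P (X ⊞ Y) := by
  have := h.closedUnderSums
  have := h.isClosedUnderIsomorphisms
  exact P.prop_of_iso (biprod.isoProd X Y).symm (P.prop_prod X Y hX hY)

end

lemma IsAdditiveSubcategory.inverseImage {D E : Type*} [Category* D] [Preadditive D]
    [HasBinaryBiproducts D] [HasZeroObject D] [HasFiniteProducts D] [Category* E] [Preadditive E]
    [HasBinaryBiproducts E] [HasZeroObject E] [HasFiniteProducts E]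
    {P : ObjectProperty E} (h : IsAdditiveSubcategory P) (F : D ⥤ E) [F.Additive] :
    IsAdditiveSubcategory (P.inverseImage F) := by
  have := h.isClosedUnderIsomorphisms
  have := h.closedUnderSummands
  have := preservesBinaryBiproducts_of_preservesBiproducts F
  exact ⟨isClosedUnderFiniteProducts_of_biprod (h.zero (F.map_isZero (isZero_zero D)))
      fun X Y hX hY => P.prop_of_iso (F.mapBiprod X Y).symm (h.biprod hX hY),
    ⟨fun r hY => P.prop_of_retract (r.map F) hY⟩⟩

variable {C : Type u} [Category.{v} C] [Abelian C]

instance : HasBinaryBiproducts (Arrow C) := .of_hasBinaryProducts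

instance : HasZeroObject (Arrow C) := hasZeroObject_of_hasInitial_object

/-! ### Projective resolutions and presentations -/

/-- The complex `⋯ ⟶ 0 ⟶ 0 ⟶ Ker f ⟶ A₁ ⟶ A₀` of iterated kernels. -/
def kernelComplex (X : Arrow C) : ChainComplex C ℕ :=
  ChainComplex.mk' X.right X.left X.hom fun f => ⟨kernel f, kernel.ι f, kernel.condition f⟩

lemma exists_kernelComplex_iso (X : Arrow C) (n : ℕ) :
    ∃ e : (kernelComplex X).X (n + 2) ≅ kernel ((kernelComplex X).d (n + 1) n),
      (kernelComplex X).d (n + 2) (n + 1) = e.hom ≫ kernel.ι _ :=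
  ⟨_, ChainComplex.mk'_d _ _ _ _ n⟩

lemma isProjRes_kernelComplex (X : Arrow C) : IsProjRes C (kernelComplex X) := by
  intro n hn
  obtain ⟨n, rfl⟩ := Nat.exists_eq_add_of_le' hn
  rw [HomologicalComplex.exactAt_iff' _ (n + 2) (n + 1) n (by simp) (by simp)]
  refine exact_of_app fun W (x : W.unop ⟶ (kernelComplex X).X (n + 1)) hx => ?_
  have hx' : x ≫ (kernelComplex X).d (n + 1) n = 0 := hx
  obtain ⟨e, he⟩ := exists_kernelComplex_iso X n
  refine ⟨(kernel.lift _ x hx' ≫ e.inv : W.unop ⟶ (kernelComplex X).X (n + 2)), ?_⟩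
  change (_ ≫ _) ≫ (kernelComplex X).d (n + 2) (n + 1) = x
  rw [he, Category.assoc, Iso.inv_hom_id_assoc, kernel.lift_ι]

/-- Every map begins the projective resolution of its own cokernel functor given by `kernelComplex`.
-/
lemma underPsi_eq_inverseImage (T : ObjectProperty (FinPresFunctor C))
    [T.IsClosedUnderIsomorphisms] : underPsi T = T.inverseImage (Phi C) := by
  ext X
  constructor
  · rintro ⟨P, hP, ⟨e⟩⟩
    exact T.prop_of_iso ((Phi C).mapIso e) hP
  · intro hX
    have e : (Psi C).obj ⟨kernelComplex X, isProjRes_kernelComplex X⟩ ≅ X :=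
      Arrow.isoMk (Iso.refl _) (Iso.refl _) (by
        change 𝟙 _ ≫ X.hom = (kernelComplex X).d 1 0 ≫ 𝟙 _
        rw [Category.id_comp, Category.comp_id]
        exact (ChainComplex.mk'_d_1_0 _ _ _ _).symm)
    exact ⟨_, T.prop_of_iso ((Phi C).mapIso e.symm) hX, ⟨e⟩⟩

/-! ### Relative tilting subcategories and the two properties -/

lemma subsingleton_extF_of_three_le (X Y : Arrow C) {k : ℕ} (hk : 3 ≤ k) :
    Subsingleton (ExtF X Y k) :=
  (subsingleton_extF_iff X Y (by omega)).2 (subsingleton_ext_of_three_le _ _ hk)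

lemma RelExtVanishing.subsingleton {T : ObjectProperty (Arrow C)} (h : RelExtVanishing T)
    {X Y : Arrow C} (hX : T X) (hY : T Y) {k : ℕ} (hk : 1 ≤ k) : Subsingleton (ExtF X Y k) := by
  obtain hk' | hk' := Nat.lt_or_ge 2 k
  · exact subsingleton_extF_of_three_le X Y hk'
  · exact h X Y hX hY k hk hk'

lemma subsingleton_ext_X₃ {A : Type*} [Category* A] [Abelian A] [HasExt.{v} A] (T : A)
    {S : ShortComplex A} (hS : S.ShortExact) {k : ℕ} (h₂ : Subsingleton (Abelian.Ext.{v} T S.X₂ k))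
    (h₁ : Subsingleton (Abelian.Ext.{v} T S.X₁ (k + 1))) :
    Subsingleton (Abelian.Ext.{v} T S.X₃ k) := by
  refine subsingleton_of_forall_eq 0 fun x => ?_
  obtain ⟨y, rfl⟩ := Abelian.Ext.covariant_sequence_exact₃ T hS x rfl (h₁.elim _ _)
  rw [h₂.elim y 0, Abelian.Ext.zero_comp]

/-- Shifting along the first two sequences, `Ext³(T₃, X) = 0` yields `Ext²(T₃, K₁) = 0` and then
`Ext¹(T₃, K₂) = 0`, all after `Phi`. So the last sequence splits, and `K₂` is a summand of `T₂`. -/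
lemma hasRelCoresolution_two_of_three {T : ObjectProperty (Arrow C)}
    (hT : IsAdditiveSubcategory T)
    (hE : ∀ X Y, T X → T Y → ∀ k : ℕ, 1 ≤ k → Subsingleton (ExtF X Y k)) {X : Arrow C}
    (h : HasRelCoresolution T 3 X) : HasRelCoresolution T 2 X := by
  obtain ⟨T₀, K₁, i₀, p₀, w₀, h₀, hS₀, T₁, K₂, i₁, p₁, w₁, h₁, hS₁, T₂, T₃, i₂, p₂, w₂, h₂, hS₂,
    h₃⟩ := h
  have h₃' : T T₃ := h₃
  have hE' (Y : Arrow C) (hY : T Y) (k : ℕ) (hk : 1 ≤ k) :=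
    (subsingleton_extF_iff T₃ Y hk).1 (hE T₃ Y h₃' hY k hk)
  have e₁ := subsingleton_ext_X₃ _ hS₀.shortExact_Phi (hE' T₀ h₀ 2 (by omega))
    (subsingleton_ext_of_three_le _ _ le_rfl)
  have e₂ := subsingleton_ext_X₃ _ hS₁.shortExact_Phi (hE' T₁ h₁ 1 le_rfl) e₁
  obtain ⟨r⟩ := hS₂.nonempty_retract e₂
  have := hT.closedUnderSummands
  exact ⟨T₀, K₁, i₀, p₀, w₀, h₀, hS₀, T₁, K₂, i₁, p₁, w₁, h₁, hS₁, T.prop_of_retract r h₂⟩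

lemma HasRelCoresolution.succ {T : ObjectProperty (Arrow C)} (hT : IsAdditiveSubcategory T) {n : ℕ}
    {X : Arrow C} (h : HasRelCoresolution T n X) : HasRelCoresolution T (n + 1) X := by
  induction n generalizing X with
  | zero => exact ⟨X, 0, 𝟙 X, 0, comp_zero, h, .of_isZero X (isZero_zero _),
      hT.zero (isZero_zero _)⟩
  | succ n ih =>
    obtain ⟨T₀, K, i, p, w, h₀, hS, hK⟩ := h
    exact ⟨T₀, K, i, p, w, h₀, hS, ih hK⟩

lemma HasRelCoresolution.pred {T : ObjectProperty (Arrow C)} (hT : IsAdditiveSubcategory T)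
    (hE : ∀ X Y, T X → T Y → ∀ k : ℕ, 1 ≤ k → Subsingleton (ExtF X Y k)) {n : ℕ} {X : Arrow C}
    (h : HasRelCoresolution T (n + 3) X) : HasRelCoresolution T (n + 2) X := by
  induction n generalizing X with
  | zero => exact hasRelCoresolution_two_of_three hT hE h
  | succ n ih =>
    obtain ⟨T₀, K, i, p, w, h₀, hS, hK⟩ := h
    exact ⟨T₀, K, i, p, w, h₀, hS, ih hK⟩

lemma HasRelCoresolution.two {T : ObjectProperty (Arrow C)} (hT : IsAdditiveSubcategory T)
    (hE : ∀ X Y, T X → T Y → ∀ k : ℕ, 1 ≤ k → Subsingleton (ExtF X Y k)) {n : ℕ} {X : Arrow C}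
    (h : HasRelCoresolution T n X) : HasRelCoresolution T 2 X := by
  obtain _ | _ | n := n
  · exact (h.succ hT).succ hT
  · exact h.succ hT
  · induction n with
    | zero => exact h
    | succ n ih => exact ih (h.pred hT hE)

/-- Relative tilting subcategories are characterized by the two properties. -/
lemma isRelativeTilting_iff {T : ObjectProperty (Arrow C)} (hT : IsAdditiveSubcategory T) :
    IsRelativeTilting T ↔ RelExtVanishing T ∧ RelCoresolutions T := by
  constructor
  · intro h
    refine ⟨fun X Y hX hY k hk _ => h.ext_vanishing X Y hX hY k hk, fun A => ?_⟩
    obtain ⟨n, hn⟩ := h.coresolution A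
    exact hn.two hT h.ext_vanishing
  · rintro ⟨hE, hR⟩
    exact ⟨hT, fun X _ => ⟨2, relProjDimLE_two X⟩,
      fun X Y hX hY k hk => hE.subsingleton hX hY hk, fun A => ⟨2, hR A⟩⟩

/-! ### The correspondence -/

lemma subsingleton_ext_of_iso {A : Type*} [Category* A] [Abelian A] [HasExt.{v} A] {M M' N N' : A}
    (e : M ≅ M') (f : N ≅ N') {k : ℕ} (h : Subsingleton (Abelian.Ext.{v} M N k)) :
    Subsingleton (Abelian.Ext.{v} M' N' k) := by
  refine subsingleton_of_forall_eq 0 fun x => ?_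
  have hx := Subsingleton.elim
    (((Abelian.Ext.mk₀ e.hom).comp x (zero_add k)).comp (Abelian.Ext.mk₀ f.inv) (add_zero k)) 0
  have hx' : (Abelian.Ext.mk₀ e.inv).comp ((((Abelian.Ext.mk₀ e.hom).comp x (zero_add k)).comp
      (Abelian.Ext.mk₀ f.inv) (add_zero k)).comp (Abelian.Ext.mk₀ f.hom) (add_zero k))
      (zero_add k) = x := by simp
  rw [← hx', hx, Abelian.Ext.zero_comp, Abelian.Ext.comp_zero]

lemma IsGeneralizedTilting.inverseImage_Phi {T : ObjectProperty (FinPresFunctor C)}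
    (h : IsGeneralizedTilting T) : IsRelativeTilting (T.inverseImage (Phi C)) where
  additive := h.additive.inverseImage (Phi C)
  projDim X _ := ⟨2, relProjDimLE_two X⟩
  ext_vanishing X Y hX hY k hk := (subsingleton_extF_iff X Y hk).2 (h.ext_vanishing _ _ hX hY k hk)
  coresolution A := by
    have := h.additive.isClosedUnderIsomorphisms
    obtain ⟨n, hn⟩ := h.coresolution A
    obtain ⟨e⟩ := nonempty_Phi_zeroTo_iso A
    exact ⟨n, hn.lift_Phi e⟩

/-- Closure under retracts stays a hypothesis: a summand of `Φ(X)` need not come from a summand of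
`X` unless idempotents lift. -/
lemma isAdditiveSubcategory_map_Phi {T : ObjectProperty (Arrow C)} (hT : IsAdditiveSubcategory T)
    (hs : (T.map (Phi C)).IsStableUnderRetracts) : IsAdditiveSubcategory (T.map (Phi C)) where
  closedUnderSums :=
    have := preservesBinaryBiproducts_of_preservesBiproducts (Phi C)
    isClosedUnderFiniteProducts_of_biprod
      ⟨0, hT.zero (isZero_zero _), ⟨(Phi C).mapZeroObject⟩⟩ fun _ _ ⟨X, hX, ⟨e⟩⟩ ⟨Y, hY, ⟨f⟩⟩ =>
        ⟨X ⊞ Y, hT.biprod hX hY, ⟨(Phi C).mapBiprod X Y ≪≫ biprod.mapIso e f⟩⟩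
  closedUnderSummands := hs

lemma IsRelativeTilting.map_Phi {T : ObjectProperty (Arrow C)} (h : IsRelativeTilting T)
    (hs : (T.map (Phi C)).IsStableUnderRetracts) : IsGeneralizedTilting (T.map (Phi C)) where
  additive := isAdditiveSubcategory_map_Phi h.additive hs
  projDim := ⟨2, fun M _ => hasProjectiveDimensionLE_two M⟩
  ext_vanishing := by
    rintro M N ⟨X, hX, ⟨e⟩⟩ ⟨Y, hY, ⟨f⟩⟩ k hk
    have := (subsingleton_extF_iff X Y hk).1 (h.ext_vanishing X Y hX hY k hk)
    exact subsingleton_ext_of_iso e f this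
  coresolution A := by
    obtain ⟨n, hn⟩ := h.coresolution A
    obtain ⟨e⟩ := nonempty_Phi_zeroTo_iso A
    exact ⟨n, hn.map_Phi.of_iso e⟩

lemma inverseImage_map_Phi {T : ObjectProperty (Arrow C)} (h : IsHomotopyClosed T) :
    (T.map (Phi C)).inverseImage (Phi C) = T := by
  rw [isHomotopyClosed_iff] at h
  ext X
  exact ⟨fun ⟨Y, hY, e⟩ => h Y X e hY, fun hX => ⟨X, hX, ⟨Iso.refl _⟩⟩⟩

lemma map_inverseImage_Phi (T : ObjectProperty (FinPresFunctor C)) [T.IsClosedUnderIsomorphisms] :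
    (T.inverseImage (Phi C)).map (Phi C) = T := by
  ext M
  constructor
  · rintro ⟨X, hX, ⟨e⟩⟩
    exact T.prop_of_iso e hX
  · intro hM
    obtain ⟨X, ⟨e⟩⟩ := exists_iso_Phi M
    exact ⟨X, T.prop_of_iso e.symm hM, ⟨e⟩⟩

lemma isHomotopyClosed_inverseImage_Phi (T : ObjectProperty (FinPresFunctor C))
    [T.IsClosedUnderIsomorphisms] : IsHomotopyClosed (T.inverseImage (Phi C)) :=
  (isHomotopyClosed_iff _).2 fun _ _ ⟨e⟩ hX => T.prop_of_iso e hX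

end

section

/-! ### Lifting of idempotents -/

open Polynomial in
/-- Modulo a monic polynomial over an artinian ring, some power of `X` generates an ideal that is
generated by an idempotent. -/
lemma exists_idempotent_polynomial {R : Type*} [CommRing R] [IsArtinianRing R] {p : R[X]}
    (hp : p.Monic) : ∃ (m : ℕ) (E y : R[X]), E = X ^ (m + 1) * y ∧ p ∣ E * E - E ∧
      p ∣ X ^ (m + 1) * E - X ^ (m + 1) := by
  have := hp.finite_adjoinRoot
  have := IsArtinianRing.of_finite R (AdjoinRoot p)
  -- The descending chain of ideals generated by powers of the root stabilizes in the artinian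
  -- quotient.
  obtain ⟨m, y, hy⟩ := IsArtinian.exists_pow_succ_smul_dvd (AdjoinRoot.root p) (1 : AdjoinRoot p)
  obtain ⟨y, rfl⟩ := AdjoinRoot.mk_surjective y
  set x := AdjoinRoot.root p
  set b := AdjoinRoot.mk p y
  have hy' : x ^ (m + 1) * b = x ^ m := by simpa using hy
  have hk (k : ℕ) : x ^ (m + k) * b ^ k = x ^ m := by
    induction k with
    | zero => simp
    | succ k ih =>
      calc x ^ (m + (k + 1)) * b ^ (k + 1) = (x ^ (m + 1) * b) * (x ^ k * b ^ k) := by ring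
        _ = x ^ (m + k) * b ^ k := by rw [hy']; ring
        _ = x ^ m := ih
  have h₂ : x ^ (m + 1) * (x ^ (m + 1) * b ^ (m + 1)) = x ^ (m + 1) := by
    calc _ = x * (x ^ (m + (m + 1)) * b ^ (m + 1)) := by ring
      _ = _ := by rw [hk]; ring
  -- The exponent is `m + 1` and not `m`, so that a positive power of `X` occurs even for `m = 0`:
  -- an idempotent agrees only with its positive powers.
  refine ⟨m, X ^ (m + 1) * y ^ (m + 1), y ^ (m + 1), rfl, AdjoinRoot.mk_eq_mk.1 ?_,
    AdjoinRoot.mk_eq_mk.1 ?_⟩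
  · simp only [map_mul, map_pow, AdjoinRoot.mk_X]
    calc _ = (x ^ (m + 1) * (x ^ (m + 1) * b ^ (m + 1))) * b ^ (m + 1) := by ring
      _ = _ := by rw [h₂]
  · simpa only [map_mul, map_pow, AdjoinRoot.mk_X] using h₂

section

variable {R Λ M N : Type*} [CommRing R] [Ring Λ] [Algebra R Λ] [AddCommGroup M] [Module Λ M]
  [Module R M] [IsScalarTower R Λ M] [AddCommGroup N] [Module Λ N] [Module R N]
  [IsScalarTower R Λ N]

/-- Cayley–Hamilton over `R`, pulled back along the injective restriction of scalars. -/
lemma exists_monic_aeval_eq_zero [Module.Finite R M] (f : Module.End Λ M) :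
    ∃ p : Polynomial R, p.Monic ∧ Polynomial.aeval f p = 0 := by
  obtain ⟨p, hp, h⟩ := LinearMap.exists_monic_and_aeval_eq_zero R (f.restrictScalars R)
  let ρ : Module.End Λ M →ₐ[R] Module.End R M :=
    AlgHom.ofLinearMap (LinearMap.restrictScalarsₗ R Λ M M R) rfl fun _ _ => rfl
  refine ⟨p, hp, LinearMap.restrictScalars_injective R ?_⟩
  exact (Polynomial.aeval_algHom_apply ρ f p).symm.trans h

lemma comp_aeval_of_comp_eq {f : Module.End Λ M} {f' : Module.End Λ N} {g : M →ₗ[Λ] N}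
    (h : g ∘ₗ f = f' ∘ₗ g) (p : Polynomial R) :
    g ∘ₗ (Polynomial.aeval f p : Module.End Λ M) =
      (Polynomial.aeval f' p : Module.End Λ N) ∘ₗ g := by
  have h' (x : M) : g (f x) = f' (g x) := LinearMap.congr_fun h x
  ext x
  simp only [LinearMap.comp_apply]
  induction p using Polynomial.induction_on' generalizing x with
  | add p q hp hq => simp only [map_add, LinearMap.add_apply, hp, hq]
  | monomial n a =>
    have hn (x : M) : g ((f ^ n) x) = (f' ^ n) (g x) := by
      induction n generalizing x with
      | zero => rfl
      | succ n ih => rw [pow_succ, pow_succ, Module.End.mul_apply, Module.End.mul_apply, ih, h']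
    simp only [Polynomial.aeval_monomial, Module.End.mul_apply, Module.algebraMap_end_apply, ← hn]
    rw [← algebraMap_smul Λ a, map_smul, algebraMap_smul]

end

variable {Λ : Type u} [Ring Λ] [IsArtinAlgebra Λ]

/-- Every idempotent endomorphism of `Φ(X)` lifts to an idempotent endomorphism of `X`. -/
lemma exists_idempotent_lift {X : Arrow (FGModuleCat.{u} Λ)}
    (e : (Phi _).obj X ⟶ (Phi _).obj X) (he : e ≫ e = e) :
    ∃ ε : X ⟶ X, ε ≫ ε = ε ∧ (Phi _).map ε = e := by
  obtain ⟨R, _, _, _, _⟩ := IsArtinAlgebra.exists_finite (Λ := Λ)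
  obtain ⟨h, rfl⟩ := (Phi _).map_surjective e
  let _ : Module R X.left := Module.compHom _ (algebraMap R Λ)
  let _ : Module R X.right := Module.compHom _ (algebraMap R Λ)
  have : IsScalarTower R Λ X.left := .of_compHom R Λ _
  have : IsScalarTower R Λ X.right := .of_compHom R Λ _
  have : Module.Finite R X.left := .trans Λ _
  have : Module.Finite R X.right := .trans Λ _
  let f₁ : Module.End Λ X.left := h.left.hom.hom
  let f₀ : Module.End Λ X.right := h.right.hom.hom
  let g : X.left →ₗ[Λ] X.right := X.hom.hom.hom
  have hg : g ∘ₗ f₁ = f₀ ∘ₗ g := congrArg (fun φ => φ.hom.hom) (Arrow.w h)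
  -- The product `p₁ * p₀` kills both components, so polynomials in `h` depend only on their class
  -- modulo this monic polynomial.
  obtain ⟨p₁, hp₁, h₁⟩ := exists_monic_aeval_eq_zero (R := R) f₁
  obtain ⟨p₀, hp₀, h₀⟩ := exists_monic_aeval_eq_zero (R := R) f₀
  let ev (q : Polynomial R) : X ⟶ X :=
    Arrow.homMk (FGModuleCat.ofHom (Polynomial.aeval f₁ q))
      (FGModuleCat.ofHom (Polynomial.aeval f₀ q))
      (by
        ext x
        exact LinearMap.congr_fun (comp_aeval_of_comp_eq hg q) x)
  have ev_comp (q r : Polynomial R) : ev q ≫ ev r = ev (q * r) := by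
    rw [mul_comm]
    refine Arrow.hom_ext _ _ ?_ ?_
    · change FGModuleCat.ofHom _ ≫ FGModuleCat.ofHom _ = FGModuleCat.ofHom _
      rw [map_mul]
      rfl
    · change FGModuleCat.ofHom _ ≫ FGModuleCat.ofHom _ = FGModuleCat.ofHom _
      rw [map_mul]
      rfl
  have ev_congr {q r : Polynomial R} (hqr : p₁ * p₀ ∣ q - r) : ev q = ev r := by
    obtain ⟨c, hc⟩ := hqr
    rw [sub_eq_iff_eq_add] at hc
    have e₁ : Polynomial.aeval f₁ q = Polynomial.aeval f₁ r := by simp [hc, h₁]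
    have e₀ : Polynomial.aeval f₀ q = Polynomial.aeval f₀ r := by simp [hc, h₀]
    dsimp only [ev]
    refine Arrow.hom_ext _ _ ?_ ?_
    · change FGModuleCat.ofHom _ = FGModuleCat.ofHom _
      rw [e₁]
    · change FGModuleCat.ofHom _ = FGModuleCat.ofHom _
      rw [e₀]
  have ev_X : ev Polynomial.X = h := by
    refine Arrow.hom_ext _ _ ?_ ?_
    · change FGModuleCat.ofHom _ = _
      rw [Polynomial.aeval_X]
      rfl
    · change FGModuleCat.ofHom _ = _
      rw [Polynomial.aeval_X]
      rfl
  have ev_pow (k : ℕ) : (Phi _).map (ev (Polynomial.X ^ (k + 1))) = (Phi _).map h := by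
    induction k with
    | zero => rw [zero_add, pow_one, ev_X]
    | succ k ih => rw [pow_succ, ← ev_comp, Functor.map_comp, ih, ev_X, he]
  obtain ⟨m, E, y, hE, hE₂, hE₃⟩ := exists_idempotent_polynomial (hp₁.mul hp₀)
  refine ⟨ev E, by rw [ev_comp, ev_congr hE₂], ?_⟩
  -- With `e = Φ(h)`: divisibility of `E` by a positive power of `X` gives `e ≫ Φ(E) = Φ(E)`, while
  -- `X ^ (m + 1) * E ≡ X ^ (m + 1)` gives `e ≫ Φ(E) = e`.
  have h₂ : (Phi _).map (ev E) = (Phi _).map h ≫ (Phi _).map (ev y) := by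
    rw [hE, ← ev_comp, Functor.map_comp, ev_pow]
  have h₃ : (Phi _).map h ≫ (Phi _).map (ev E) = (Phi _).map h := by
    rw [← ev_pow m, ← Functor.map_comp, ev_comp, ev_congr hE₃]
  rw [← h₃, h₂, ← Category.assoc, he]

/-- A retract of `Φ(X)` is cut out by an idempotent; lift it to `X` and split it there. The
resulting summand of `X` lies in `T`, and its image is the retract because splittings are unique. -/
lemma isStableUnderRetracts_map_Phi {T : ObjectProperty (Arrow (FGModuleCat.{u} Λ))}
    [T.IsStableUnderRetracts] : (T.map (Phi _)).IsStableUnderRetracts where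
  of_retract := by
    rintro M N r ⟨X, hX, ⟨e⟩⟩
    let r' : Retract M ((Phi _).obj X) := r.trans (.ofIso e.symm)
    obtain ⟨ε, hε, hε'⟩ := exists_idempotent_lift (r'.r ≫ r'.i) (by simp)
    have : IsIdempotentComplete (Arrow (FGModuleCat.{u} Λ)) :=
      (Idempotents.isIdempotentComplete_iff_hasEqualizer_of_id_and_idempotent _).2
        fun _ _ _ => inferInstance
    obtain ⟨Y, i, q, h₁, h₂⟩ := IsIdempotentComplete.idempotents_split X ε hε
    refine ⟨Y, T.prop_of_retract ⟨i, q, h₁⟩ hX,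
      ⟨⟨(Phi _).map i ≫ r'.r, r'.i ≫ (Phi _).map q, ?_, ?_⟩⟩⟩
    · have : (Phi _).map i ≫ (r'.r ≫ r'.i) ≫ (Phi _).map q = 𝟙 _ := by
        rw [← hε', ← h₂, ← Functor.map_comp, ← Functor.map_comp, Category.assoc, h₁,
          Category.comp_id, h₁, CategoryTheory.Functor.map_id]
      simpa using this
    · have : r'.i ≫ ((Phi _).map q ≫ (Phi _).map i) ≫ r'.r = 𝟙 _ := by
        rw [← Functor.map_comp, h₂, hε']
        simp
      simpa using this

end

end MapsTilting

/-! ### Assembly of the correspondence -/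

theorem mainTheorem5 (Λ : Type u) [Ring Λ] [IsArtinAlgebra Λ] :
    -- the correspondence under `Ψ`, with inverse `𝒯 ↦ Φ(𝒯)`
    (Set.BijOn (fun T : ObjectProperty (MapsTilting.FinPresFunctor (FGModuleCat.{u} Λ)) =>
        MapsTilting.underPsi T)
      {T | MapsTilting.IsGeneralizedTilting T}
      {𝒯 | MapsTilting.IsHomotopyClosed 𝒯 ∧ MapsTilting.IsRelativeTilting 𝒯 ∧
        MapsTilting.RelExtVanishing 𝒯 ∧ MapsTilting.RelCoresolutions 𝒯}) ∧
    (Set.InvOn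
      (fun 𝒯 : ObjectProperty (Arrow (FGModuleCat.{u} Λ)) => 𝒯.map (MapsTilting.Phi _))
      (fun T : ObjectProperty (MapsTilting.FinPresFunctor (FGModuleCat.{u} Λ)) =>
        MapsTilting.underPsi T)
      {T | MapsTilting.IsGeneralizedTilting T}
      {𝒯 | MapsTilting.IsHomotopyClosed 𝒯 ∧ MapsTilting.IsRelativeTilting 𝒯 ∧
        MapsTilting.RelExtVanishing 𝒯 ∧ MapsTilting.RelCoresolutions 𝒯}) ∧
    -- the image under `Φ` of any relative tilting subcategory with the two properties
    (∀ 𝒯 : ObjectProperty (Arrow (FGModuleCat.{u} Λ)),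
      MapsTilting.IsRelativeTilting 𝒯 → MapsTilting.RelExtVanishing 𝒯 →
        MapsTilting.RelCoresolutions 𝒯 →
          MapsTilting.IsGeneralizedTilting (𝒯.map (MapsTilting.Phi _))) ∧
    -- the two properties characterize relative tilting subcategories
    (∀ 𝒯 : ObjectProperty (Arrow (FGModuleCat.{u} Λ)),
      MapsTilting.IsAdditiveSubcategory 𝒯 →
        (MapsTilting.IsRelativeTilting 𝒯 ↔
          MapsTilting.RelExtVanishing 𝒯 ∧ MapsTilting.RelCoresolutions 𝒯)) := by
  have hinv : Set.InvOn
      (fun 𝒯 : ObjectProperty (Arrow (FGModuleCat.{u} Λ)) => 𝒯.map (MapsTilting.Phi _))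
      (fun T : ObjectProperty (MapsTilting.FinPresFunctor (FGModuleCat.{u} Λ)) =>
        MapsTilting.underPsi T)
      {T | MapsTilting.IsGeneralizedTilting T}
      {𝒯 | MapsTilting.IsHomotopyClosed 𝒯 ∧ MapsTilting.IsRelativeTilting 𝒯 ∧
        MapsTilting.RelExtVanishing 𝒯 ∧ MapsTilting.RelCoresolutions 𝒯} := by
    constructor
    · intro T (hT : MapsTilting.IsGeneralizedTilting T)
      have := hT.additive.isClosedUnderIsomorphisms
      dsimp only
      rw [MapsTilting.underPsi_eq_inverseImage, MapsTilting.map_inverseImage_Phi]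
    · rintro 𝒯 ⟨h𝒯, -⟩
      dsimp only
      rw [MapsTilting.underPsi_eq_inverseImage, MapsTilting.inverseImage_map_Phi h𝒯]
  have hPhi (𝒯 : ObjectProperty (Arrow (FGModuleCat.{u} Λ)))
      (h : MapsTilting.IsRelativeTilting 𝒯) :
      MapsTilting.IsGeneralizedTilting (𝒯.map (MapsTilting.Phi _)) :=
    have := h.additive.closedUnderSummands
    h.map_Phi MapsTilting.isStableUnderRetracts_map_Phi
  refine ⟨hinv.bijOn ?_ fun 𝒯 h𝒯 => hPhi 𝒯 h𝒯.2.1, hinv, fun 𝒯 h𝒯 _ _ => hPhi 𝒯 h𝒯,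
    fun 𝒯 h𝒯 => MapsTilting.isRelativeTilting_iff h𝒯⟩
  intro T (hT : MapsTilting.IsGeneralizedTilting T)
  have := hT.additive.isClosedUnderIsomorphisms
  have h := hT.inverseImage_Phi
  dsimp only
  rw [MapsTilting.underPsi_eq_inverseImage]
  exact ⟨MapsTilting.isHomotopyClosed_inverseImage_Phi T, h,
    (MapsTilting.isRelativeTilting_iff h.additive).1 h⟩

end
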